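/- **Theorem (Dicke state unitaries on grids).** For $0\le \ell\le n$ let $|D^n_\ell\rangle=\binom n\ell^{-1/2}\sum_{x\in\{0,1\}^n,\ \mathrm{HW}(x)=\ell}|x\rangle$ be the $n$-qubit Dicke state, where $\mathrm{HW}(x)$ is the number of ones in $x$. For $k\le n$, a Dicke state unitary $U_{n,k}$ is any unitary on $n$ qubits with $U_{n,k}|0^{n-\ell}1^{\ell}\rangle=|D^n_\ell\rangle$ for all $0\le\ell\le k$. A circuit consists of arbitrary one- and two-qubit unitary gates arranged in layers of gates on disjoint qubits; its depth is the number of layers. For all constants $c,C>0$ there is a constant $K>0$, depending only on $c$ and $C$, such that the following holds for all integers $1\le k\le n$, all real $s$ with $1\le s\le k$, and all integers $a\le b$ with $ab\ge n$, $a\ge c\sqrt{n/s}$ and $b\le C\sqrt{ns}$ (that is, for grids of size $\Omega(\sqrt{n/s})\times O(\sqrt{ns})$ with at least $n$ sites, the shorter side named first). The $n$ qubits can be placed on distinct sites of the $a\times b$ Cartesian grid so that some Dicke state unitary $U_{n,k}$ is implemented exactly by a circuit on these $n$ qubits only (no ancilla qubits), all of whose two-qubit gates act on pairs of qubits at adjacent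 grid sites, which has depth at most $K\,k\sqrt{n/k}=K\sqrt{nk}$ and at most $K\,kn$ gates in total (in particular $O(kn)$ two-qubit gates). -/

import Mathlib

namespace DickeCircuit

/-- Computational basis states (bitstrings) of a register whose qubits are labelled by `Q`. -/
abbrev Bits (Q : Type) := Q → Bool

/-- Number of ones in a bitstring. -/
def hammingWeight {n : ℕ} (x : Bits (Fin n)) : ℕ :=
  (Finset.univ.filter fun i => x i = true).card

/-- The bitstring `0^(n-l) 1^l`; qubit `0` is the least significant one, so the ones sit on the
qubits `0, …, l-1`. -/
def unaryBits (n l : ℕ) : Bits (Fin n) := fun i => decide (i.val < l)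

/-- The computational basis vector `|x⟩`. -/
def ket {n : ℕ} (x : Bits (Fin n)) : Bits (Fin n) → ℂ := Pi.single x 1

/-- The Dicke state `|D^n_l⟩`: the equal-amplitude superposition of all `n`-bit strings of Hamming
weight `l`. -/
noncomputable def dickeState (n l : ℕ) : Bits (Fin n) → ℂ := fun x =>
  if hammingWeight x = l then (((Real.sqrt (n.choose l : ℝ))⁻¹ : ℝ) : ℂ) else 0

/-- `U` is a Dicke state unitary `U_{n,k}`: a unitary with `U |0^(n-l) 1^l⟩ = |D^n_l⟩` for all
`l ≤ k` (used for `k ≤ n`). -/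
def IsDickeUnitary (n k : ℕ) (U : Matrix (Bits (Fin n)) (Bits (Fin n)) ℂ) : Prop :=
  U ∈ Matrix.unitaryGroup (Bits (Fin n)) ℂ ∧
    ∀ l ≤ k, U.mulVec (ket (unaryBits n l)) = dickeState n l

/-- Elementary gates: arbitrary one-qubit unitaries, and arbitrary two-qubit unitaries on two
distinct qubits. -/
inductive Gate (Q : Type) : Type
  | one (q : Q) (U : Matrix.unitaryGroup Bool ℂ) : Gate Q
  | two (p q : Q) (hpq : p ≠ q) (U : Matrix.unitaryGroup (Bool × Bool) ℂ) : Gate Q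

/-- The qubits a gate acts on. -/
def Gate.support {Q : Type} : Gate Q → Set Q
  | .one q _ => {q}
  | .two p q _ _ => {p, q}

open Classical in
/-- The operator of a gate on the whole register: the given unitary on the qubits of the gate,
tensored with the identity on all other qubits. -/
noncomputable def Gate.matrix {Q : Type} : Gate Q → Matrix (Bits Q) (Bits Q) ℂ
  | .one q U => fun x y =>
      if ∀ r, r ≠ q → x r = y r then U.1 (x q) (y q) else 0
  | .two p q _ U => fun x y =>
      if ∀ r, r ≠ p → r ≠ q → x r = y r then U.1 (x p, x q) (y p, y q) else 0

/-- A gate is admissible on a connectivity graph if it acts on one qubit or on two adjacent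
qubits. -/
def Gate.Respects {Q : Type} (G : SimpleGraph Q) : Gate Q → Prop
  | .one _ _ => True
  | .two p q _ _ => G.Adj p q

/-- One time step of a circuit: gates acting on pairwise disjoint sets of qubits. -/
structure Layer (Q : Type) : Type where
  gates : List (Gate Q)
  disjoint : gates.Pairwise fun g h => Disjoint g.support h.support

/-- The operator of a layer (its gates commute, so their order does not matter). -/
noncomputable def Layer.matrix {Q : Type} [Fintype Q] [DecidableEq Q] (L : Layer Q) :
    Matrix (Bits Q) (Bits Q) ℂ :=
  (L.gates.map Gate.matrix).prod

/-- A circuit without ancillas or measurements on the qubits `Q`: a sequence of layers, the head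
of the list being executed first. -/
abbrev Circuit (Q : Type) := List (Layer Q)

/-- The operator implemented by a circuit. -/
noncomputable def Circuit.matrix {Q : Type} [Fintype Q] [DecidableEq Q] :
    Circuit Q → Matrix (Bits Q) (Bits Q) ℂ
  | [] => 1
  | L :: C => Circuit.matrix C * L.matrix

/-- Depth: the number of time steps. -/
def Circuit.depth {Q : Type} (C : Circuit Q) : ℕ := C.length

/-- Total number of gates, one-qubit and two-qubit gates alike. -/
def Circuit.size {Q : Type} (C : Circuit Q) : ℕ := (C.map fun L => L.gates.length).sum

/-- All two-qubit gates of the circuit act along edges of the connectivity graph. -/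
def Circuit.Respects {Q : Type} (G : SimpleGraph Q) (C : Circuit Q) : Prop :=
  ∀ L ∈ C, ∀ g ∈ L.gates, g.Respects G

/-- The Cartesian grid with `a` rows and `b` columns. -/
abbrev grid (a b : ℕ) : SimpleGraph (Fin a × Fin b) :=
  (SimpleGraph.pathGraph a).boxProd (SimpleGraph.pathGraph b)

end DickeCircuit

/-! By Vandermonde, the Dicke state of weight `l` on a disjoint union `W₁ ∪ W₂` is a superposition
over `b` of products of Dicke states of weights `b` and `l - b`, with squared amplitudes `C(|W₁|,b)
C(|W₂|,l-b) / C(|W₁|+|W₂|,l)`. Hence it suffices to turn a unary `l` into this superposition of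
unary pairs `(b, l - b)`, for all `l ≤ k` at once, and to recurse on both parts in parallel
(`PreparesDicke.merge`). As `l ≤ k`, unary registers of `min k |Wᵢ|` cells are long enough.

The distribution runs in depth `O(p + q)` on a path carrying registers of `p` and `q` cells
(`exists_distribution`). A swap network moves the registers through each other, so that each line
`i` of the first meets each line `j` of the second exactly once, with lines `i + 1` and `j - 1` on
the two outer sides. At the meeting a rotation, controlled by these two neighbours, sends content
`(i + 1, j)` to a combination of `(i + 1, j)` and `(i, j + 1)`. The meeting determines the weight `l
= i + j + 1`, so one wave serves all weights, each with its own angles. For fixed `l` the meetings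
come in increasing order of `j`, and the amplitude cascades from one value of `b` to the next
(`exists_waveStep`).

On a path of `L` cells, splitting off at most `k` cells at a time gives depth `O(L)` and `O(kL)`
gates (`exists_pathDicke`). To reach depth `√(nk)`, the grid is cut into at most `n/√(nk)`
horizontal strips of `O(√(nk))` cells. Blocks of `O(k)` cells at the left ends of the strips form a
spine along which the weight is distributed strip by strip; the strips then work in parallel as
paths (`exists_combDicke`, `exists_circuit_of_large`). If `n = O(k)`, a single boustrophedon path is
good enough (`exists_circuit_snake`). -/

namespace DickeCircuit

/-! ### Gate lists as operators -/

section Operators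

variable {Q : Type} [Fintype Q] [DecidableEq Q]

/-- The operator of a sequence of gates, the head of the list being executed first. -/
noncomputable def gateProd : List (Gate Q) → Matrix (Bits Q) (Bits Q) ℂ
  | [] => 1
  | g :: gs => gateProd gs * g.matrix

theorem gateProd_append (as bs : List (Gate Q)) :
    gateProd (as ++ bs) = gateProd bs * gateProd as := by
  induction as with
  | nil => simp [gateProd]
  | cons a as ih => simp [gateProd, ih, Matrix.mul_assoc]

/-- The basis vector of a bitstring. -/
def basisVec (v : Bits Q) : Bits Q → ℂ := Pi.single v 1

/-- The linear action of a sequence of gates on state vectors. -/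
noncomputable def act (gs : List (Gate Q)) : (Bits Q → ℂ) →ₗ[ℂ] (Bits Q → ℂ) :=
  (gateProd gs).mulVecLin

@[simp] theorem act_nil (v : Bits Q → ℂ) : act [] v = v := by
  simp [act, gateProd]

theorem act_append (as bs : List (Gate Q)) (v : Bits Q → ℂ) :
    act (as ++ bs) v = act bs (act as v) := by
  simp [act, gateProd_append, Matrix.mulVec_mulVec]

theorem act_cons (g : Gate Q) (gs : List (Gate Q)) (v : Bits Q → ℂ) :
    act (g :: gs) v = act gs (act [g] v) := act_append [g] gs v

theorem act_two_basisVec (p q : Q) (hpq : p ≠ q) (U : Matrix.unitaryGroup (Bool × Bool) ℂ)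
    (y : Bits Q) :
    act [Gate.two p q hpq U] (basisVec y) = ∑ c : Bool × Bool,
      U.1 c (y p, y q) • basisVec (Function.update (Function.update y p c.1) q c.2) := by
  ext x
  simp only [act, gateProd, Matrix.one_mul, Matrix.mulVecLin_apply, basisVec,
    Matrix.mulVec_single_one, Matrix.col_apply]
  simp only [Gate.matrix, Finset.sum_apply, Pi.smul_apply, smul_eq_mul]
  split_ifs with h
  · rw [Finset.sum_eq_single (x p, x q)]
    · have : x = Function.update (Function.update y p (x p)) q (x q) := by
        ext r
        by_cases hq : r = q
        · subst hq; simp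
        · by_cases hp : r = p
          · subst hp; simp [hq]
          · simp [hq, hp, h r hp hq]
      rw [← this]
      simp
    · intro c _ hc
      rw [Pi.single_eq_of_ne, mul_zero]
      rintro rfl
      apply hc
      simp [hpq]
    · simp
  · symm
    apply Finset.sum_eq_zero
    intro c _
    rw [Pi.single_eq_of_ne, mul_zero]
    rintro rfl
    apply h
    intro r hp hq
    simp [hp, hq]

theorem sum_update_update {p q : Q} (hpq : p ≠ q) (z : Bits Q) (F : Bits Q → ℂ)
    (hF : ∀ x, (¬ ∀ r, r ≠ p → r ≠ q → x r = z r) → F x = 0) :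
    ∑ x, F x = ∑ c : Bool × Bool, F (Function.update (Function.update z p c.1) q c.2) := by
  symm
  apply Finset.sum_of_injOn (fun c : Bool × Bool => Function.update (Function.update z p c.1) q c.2)
  · rintro ⟨a, b⟩ _ ⟨a', b'⟩ _ h
    have h1 := congrFun h p
    have h2 := congrFun h q
    simp [hpq] at h1 h2
    simp [h1, h2]
  · simp
  · intro x _ hx
    apply hF
    intro h
    apply hx
    refine ⟨(x p, x q), by simp, ?_⟩
    ext r
    by_cases hq : r = q
    · subst hq; simp
    · by_cases hp : r = p
      · subst hp; simp [hq]
      · simp [hq, hp, h r hp hq]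
  · simp

theorem sum_update {q : Q} (z : Bits Q) (F : Bits Q → ℂ)
    (hF : ∀ x, (¬ ∀ r, r ≠ q → x r = z r) → F x = 0) :
    ∑ x, F x = ∑ c : Bool, F (Function.update z q c) := by
  symm
  apply Finset.sum_of_injOn (fun c : Bool => Function.update z q c)
  · rintro a _ a' _ h
    simpa using congrFun h q
  · simp
  · intro x _ hx
    apply hF
    intro h
    apply hx
    refine ⟨x q, by simp, ?_⟩
    ext r
    by_cases hq : r = q
    · subst hq; simp
    · simp [hq, h r hq]
  · simp

theorem Gate.matrix_mem_unitaryGroup (g : Gate Q) :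
    g.matrix ∈ Matrix.unitaryGroup (Bits Q) ℂ := by
  rw [Matrix.mem_unitaryGroup_iff']
  ext x y
  rw [Matrix.mul_apply]
  simp only [Matrix.star_apply]
  cases g with
  | one q U =>
    have hU := congrFun (congrFun (Matrix.mem_unitaryGroup_iff'.1 U.2) (x q)) (y q)
    rw [Matrix.mul_apply] at hU
    simp only [Matrix.star_apply] at hU
    rw [sum_update (q := q) y]
    · have : ∀ c : Bool, star ((Gate.one q U).matrix (Function.update y q c) x) *
          (Gate.one q U).matrix (Function.update y q c) y =
          if ∀ r, r ≠ q → y r = x r then star (U.1 c (x q)) * U.1 c (y q) else 0 := by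
        intro c
        have e : (∀ r, r ≠ q → Function.update y q c r = x r) ↔ ∀ r, r ≠ q → y r = x r := by
          refine forall_congr' fun r => forall_congr' fun hr => ?_
          simp [hr]
        simp only [Gate.matrix, e, Function.update_self]
        rw [if_pos (c := ∀ r, r ≠ q → Function.update y q c r = y r)
          (fun r hr => by simp [hr])]
        split_ifs <;> simp
      simp only [this]
      split_ifs with h
      · rw [hU]
        have : (x q = y q) ↔ x = y := by
          constructor
          · intro hq
            ext r
            by_cases hr : r = q
            · subst hr; exact hq
            · exact (h r hr).symm
          · rintro rfl; rfl
        simp [Matrix.one_apply, this]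
      · rw [Matrix.one_apply_ne]
        · simp
        · rintro rfl
          exact h fun _ _ => rfl
    · intro z hz
      simp [Gate.matrix, hz]
  | two p q hpq U =>
    have hU := congrFun (congrFun (Matrix.mem_unitaryGroup_iff'.1 U.2) (x p, x q)) (y p, y q)
    rw [Matrix.mul_apply] at hU
    simp only [Matrix.star_apply] at hU
    rw [sum_update_update hpq y]
    · have : ∀ c : Bool × Bool, star ((Gate.two p q hpq U).matrix
          (Function.update (Function.update y p c.1) q c.2) x) *
          (Gate.two p q hpq U).matrix (Function.update (Function.update y p c.1) q c.2) y =
          if ∀ r, r ≠ p → r ≠ q → y r = x r then star (U.1 c (x p, x q)) * U.1 c (y p, y q)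
          else 0 := by
        intro c
        have e : (∀ r, r ≠ p → r ≠ q → Function.update (Function.update y p c.1) q c.2 r = x r) ↔
            ∀ r, r ≠ p → r ≠ q → y r = x r := by
          refine forall_congr' fun r => forall_congr' fun hr => forall_congr' fun hr' => ?_
          simp [hr, hr']
        simp only [Gate.matrix, e, Function.update_self, Function.update_of_ne hpq]
        rw [if_pos (c := ∀ r, r ≠ p → r ≠ q →
          Function.update (Function.update y p c.1) q c.2 r = y r)
          (fun r hr hr' => by simp [hr, hr'])]
        split_ifs <;> simp
      simp only [this]
      split_ifs with h
      · rw [hU]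
        have : ((x p, x q) = (y p, y q)) ↔ x = y := by
          constructor
          · intro hq
            rw [Prod.mk.injEq] at hq
            ext r
            by_cases hr : r = q
            · subst hr; exact hq.2
            · by_cases hr' : r = p
              · subst hr'; exact hq.1
              · exact (h r hr' hr).symm
          · rintro rfl; rfl
        simp only [Matrix.one_apply, this]
      · rw [Matrix.one_apply_ne]
        · simp
        · rintro rfl
          exact h fun _ _ _ => rfl
    · intro z hz
      simp [Gate.matrix, hz]

theorem gateProd_mem_unitaryGroup (gs : List (Gate Q)) :
    gateProd gs ∈ Matrix.unitaryGroup (Bits Q) ℂ := by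
  induction gs with
  | nil => exact one_mem _
  | cons g gs ih => exact mul_mem ih g.matrix_mem_unitaryGroup

/-- `M` acts only on the qubits in `S`: tensor product of an operator on `S` with the identity. -/
structure ActsOn (S : Set Q) (M : Matrix (Bits Q) (Bits Q) ℂ) : Prop where
  eq_zero : ∀ x y, (¬ ∀ r, r ∉ S → x r = y r) → M x y = 0
  congr : ∀ x y x' y', (∀ r, r ∉ S → x r = y r) → (∀ r, r ∉ S → x' r = y' r) →
    (∀ r ∈ S, x r = x' r) → (∀ r ∈ S, y r = y' r) → M x y = M x' y'

theorem Gate.actsOn {Q : Type} (g : Gate Q) : ActsOn g.support g.matrix := by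
  cases g with
  | one q U =>
    constructor
    · intro x y h
      simp only [Gate.matrix]
      rw [if_neg]
      simpa [Gate.support] using h
    · intro x y x' y' h h' hx hy
      simp only [Gate.support, Set.mem_singleton_iff, forall_eq] at h h' hx hy
      simp only [Gate.matrix]
      rw [if_pos h, if_pos h', hx, hy]
  | two p q hpq U =>
    constructor
    · intro x y h
      simp only [Gate.matrix]
      rw [if_neg]
      simpa [Gate.support] using h
    · intro x y x' y' h h' hx hy
      simp only [Gate.support, Set.mem_insert_iff, Set.mem_singleton_iff, forall_eq_or_imp,
        forall_eq, not_or, and_imp] at h h' hx hy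
      simp only [Gate.matrix]
      rw [if_pos h, if_pos h', hx.1, hx.2, hy.1, hy.2]

-- In the sum over intermediate bitstrings only one survives: it must agree with `x` off `S` because
-- of `M`, and with `y` off `T`, hence on `S`, because of `N`.
open Classical in
theorem ActsOn.mul_apply_eq {S T : Set Q} (hST : Disjoint S T) {M N : Matrix (Bits Q) (Bits Q) ℂ}
    (hM : ActsOn S M) (hN : ActsOn T N) (x y : Bits Q) :
    (M * N) x y = M x (S.piecewise y x) * N (S.piecewise y x) y := by
  rw [Matrix.mul_apply, Finset.sum_eq_single (S.piecewise y x)]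
  · intro z _ hz
    by_cases h : ∀ r, r ∉ S → x r = z r
    · rw [hN.eq_zero, mul_zero]
      intro h'
      apply hz
      ext r
      by_cases hr : r ∈ S
      · simp [hr, h' r (Set.disjoint_left.1 hST hr)]
      · simp [hr, h r hr]
    · rw [hM.eq_zero _ _ h, zero_mul]
  · simp

open Classical in
theorem ActsOn.commute {S T : Set Q} (hST : Disjoint S T) {M N : Matrix (Bits Q) (Bits Q) ℂ}
    (hM : ActsOn S M) (hN : ActsOn T N) : M * N = N * M := by
  ext x y
  rw [hM.mul_apply_eq hST hN, hN.mul_apply_eq hST.symm hM]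
  by_cases h : ∀ r, r ∉ S → r ∉ T → x r = y r
  · have h1 : ∀ r ∈ S, r ∉ T := fun r hr => Set.disjoint_left.1 hST hr
    have h2 : ∀ r ∈ T, r ∉ S := fun r hr => Set.disjoint_right.1 hST hr
    rw [mul_comm]
    congr 1
    · apply hN.congr
      · intro r hr
        by_cases hs : r ∈ S
        · simp [hs]
        · simp [hs, h r hs hr]
      · intro r hr
        simp [hr]
      · intro r hr
        simp [h2 r hr]
      · intro r hr
        simp [hr]
    · apply hM.congr
      · intro r hr
        simp [hr]
      · intro r hr
        by_cases hs : r ∈ T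
        · simp [hs]
        · simp [hs, h r hr hs]
      · intro r hr
        simp [h1 r hr]
      · intro r hr
        simp [hr]
  · push Not at h
    obtain ⟨r, hS, hT, hr⟩ := h
    rw [hN.eq_zero, hM.eq_zero (T.piecewise y x)]
    · simp
    · intro h
      have := h r hS
      simp [hT] at this
      exact hr this
    · intro h
      have := h r hT
      simp [hS] at this
      exact hr this

theorem Gate.matrix_commute {g h : Gate Q} (hd : Disjoint g.support h.support) :
    g.matrix * h.matrix = h.matrix * g.matrix :=
  g.actsOn.commute hd h.actsOn

end Operators

/-! ### Scheduling gate lists into layers -/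

section Scheduling

variable {Q : Type}

/-- Gates with overlapping supports carry strictly increasing time stamps. -/
def Timed (a b : ℕ × Gate Q) : Prop := ¬ Disjoint a.2.support b.2.support → a.1 < b.1

/-- The gate list `gs` uses only edges of `G` and qubits in `S`, and can be executed in `D` time
steps. -/
structure Sched (G : SimpleGraph Q) (S : Set Q) (D : ℕ) (gs : List (Gate Q)) : Prop where
  respects : ∀ g ∈ gs, g.Respects G
  support : ∀ g ∈ gs, g.support ⊆ S
  timed : ∃ ts : List (ℕ × Gate Q), ts.map Prod.snd = gs ∧ ts.Pairwise Timed ∧ ∀ t ∈ ts, t.1 < D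

theorem Sched.nil (G : SimpleGraph Q) (S : Set Q) (D : ℕ) : Sched G S D [] :=
  ⟨by simp, by simp, [], by simp⟩

theorem Sched.single {G : SimpleGraph Q} {S : Set Q} {g : Gate Q} (h : g.Respects G)
    (hS : g.support ⊆ S) : Sched G S 1 [g] :=
  ⟨by simpa, by simpa, [(0, g)], by simp⟩

theorem Sched.mono {G : SimpleGraph Q} {S S' : Set Q} {D D' : ℕ} {gs : List (Gate Q)}
    (h : Sched G S D gs) (hS : S ⊆ S') (hD : D ≤ D') : Sched G S' D' gs := by
  obtain ⟨ts, h1, h2, h3⟩ := h.timed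
  exact ⟨h.respects, fun g hg => (h.support g hg).trans hS, ts, h1, h2,
    fun t ht => (h3 t ht).trans_le hD⟩

theorem Sched.append {G : SimpleGraph Q} {S : Set Q} {D D' : ℕ} {gs gs' : List (Gate Q)}
    (h : Sched G S D gs) (h' : Sched G S D' gs') : Sched G S (D + D') (gs ++ gs') := by
  obtain ⟨ts, h1, h2, h3⟩ := h.timed
  obtain ⟨ts', h1', h2', h3'⟩ := h'.timed
  refine ⟨?_, ?_, ts ++ ts'.map (fun t => (D + t.1, t.2)), ?_, ?_, ?_⟩
  · intro g hg
    rcases List.mem_append.1 hg with hg | hg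
    exacts [h.respects g hg, h'.respects g hg]
  · intro g hg
    rcases List.mem_append.1 hg with hg | hg
    exacts [h.support g hg, h'.support g hg]
  · simp only [List.map_append, h1, List.map_map, ← h1']
    rfl
  · rw [List.pairwise_append]
    refine ⟨h2, ?_, ?_⟩
    · rw [List.pairwise_map]
      exact h2'.imp fun {a b} hab hd => Nat.add_lt_add_left (hab hd) D
    · intro a ha b hb _
      obtain ⟨t, _, rfl⟩ := List.mem_map.1 hb
      exact (h3 a ha).trans_le (Nat.le_add_right _ _)
  · intro t ht
    rcases List.mem_append.1 ht with ht | ht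
    · exact (h3 t ht).trans_le (Nat.le_add_right _ _)
    · obtain ⟨u, hu, rfl⟩ := List.mem_map.1 ht
      exact Nat.add_lt_add_left (h3' u hu) D

/-- Gate lists on disjoint sets of qubits run in parallel. -/
theorem Sched.append_disjoint {G : SimpleGraph Q} {S S' : Set Q} {D : ℕ}
    {gs gs' : List (Gate Q)} (h : Sched G S D gs) (h' : Sched G S' D gs') (hd : Disjoint S S') :
    Sched G (S ∪ S') D (gs ++ gs') := by
  obtain ⟨ts, h1, h2, h3⟩ := h.timed
  obtain ⟨ts', h1', h2', h3'⟩ := h'.timed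
  refine ⟨?_, ?_, ts ++ ts', by simp [h1, h1'], ?_, ?_⟩
  · intro g hg
    rcases List.mem_append.1 hg with hg | hg
    exacts [h.respects g hg, h'.respects g hg]
  · intro g hg
    rcases List.mem_append.1 hg with hg | hg
    exacts [(h.support g hg).trans Set.subset_union_left,
      (h'.support g hg).trans Set.subset_union_right]
  · rw [List.pairwise_append]
    refine ⟨h2, h2', ?_⟩
    intro a ha b hb hn
    refine absurd (hd.mono (h.support a.2 ?_) (h'.support b.2 ?_)) hn
    · rw [← h1]; exact List.mem_map_of_mem ha
    · rw [← h1']; exact List.mem_map_of_mem hb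
  · intro t ht
    rcases List.mem_append.1 ht with ht | ht
    exacts [h3 t ht, h3' t ht]

theorem Sched.flatMap_disjoint {ι : Type*} {G : SimpleGraph Q} {S : ι → Set Q} {D : ℕ}
    {F : ι → List (Gate Q)} (J : List ι) (h : ∀ j ∈ J, Sched G (S j) D (F j))
    (hd : J.Pairwise fun i j => Disjoint (S i) (S j)) :
    Sched G (⋃ j ∈ J, S j) D (J.flatMap F) := by
  induction J with
  | nil => exact Sched.nil _ _ _
  | cons j J ih =>
    rw [List.pairwise_cons] at hd
    have h1 := h j (by simp)
    have h2 := ih (fun i hi => h i (by simp [hi])) hd.2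
    rw [List.flatMap_cons]
    refine (h1.append_disjoint h2 ?_).mono ?_ le_rfl
    · simpa using hd.1
    · simp

variable [Fintype Q] [DecidableEq Q]

/-- A gate with positive stamp that precedes a gate stamped `0` must be disjoint from it, so the two
commute and all gates stamped `0` can be pulled to the front. -/
theorem gateProd_filter_time (ts : List (ℕ × Gate Q)) (h : ts.Pairwise Timed) :
    gateProd (ts.map Prod.snd) = gateProd ((ts.filter fun t => !decide (t.1 = 0)).map Prod.snd) *
      gateProd ((ts.filter fun t => decide (t.1 = 0)).map Prod.snd) := by
  induction ts with
  | nil => simp [gateProd]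
  | cons a ts ih =>
    rw [List.pairwise_cons] at h
    by_cases ha : a.1 = 0
    · simp [ha, gateProd, ih h.2, Matrix.mul_assoc]
    · simp only [List.map_cons, gateProd, ih h.2, ha, decide_false, Bool.not_false,
        List.filter_cons_of_pos, Bool.false_eq_true, not_false_eq_true, List.filter_cons_of_neg,
        Matrix.mul_assoc]
      congr 1
      have key : ∀ t ∈ ts.filter fun t => decide (t.1 = 0),
          Disjoint a.2.support t.2.support := by
        intro t ht
        rw [List.mem_filter, decide_eq_true_eq] at ht
        by_contra hn
        have := h.1 t ht.1 hn
        omega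
      generalize (ts.filter fun t => decide (t.1 = 0)) = us at key
      induction us with
      | nil => simp [gateProd]
      | cons u us ihu =>
        simp only [List.map_cons, gateProd, Matrix.mul_assoc]
        rw [← Gate.matrix_commute (key u (by simp)), ← Matrix.mul_assoc,
          ihu (fun t ht => key t (by simp [ht])), Matrix.mul_assoc]

/-- The gates stamped `0` are pairwise disjoint and form the first layer; lowering the other stamps
by one leaves a list for `D - 1` steps. Empty layers are allowed, so the depth is exactly `D`. -/
theorem exists_circuit_of_timed (G : SimpleGraph Q) (D : ℕ) (ts : List (ℕ × Gate Q))
    (h : ts.Pairwise Timed) (hD : ∀ t ∈ ts, t.1 < D) (hG : ∀ t ∈ ts, t.2.Respects G) :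
    ∃ C : Circuit Q, C.Respects G ∧ C.matrix = gateProd (ts.map Prod.snd) ∧ C.depth = D ∧
      C.size = ts.length := by
  induction D generalizing ts with
  | zero =>
    have : ts = [] := by
      cases ts with
      | nil => rfl
      | cons a ts => exact absurd (hD a (by simp)) (by simp)
    subst this
    exact ⟨[], by simp [Circuit.Respects, Circuit.matrix, gateProd, Circuit.depth, Circuit.size]⟩
  | succ D ih =>
    set us := ts.filter fun t => !decide (t.1 = 0) with hus
    set vs := ts.filter fun t => decide (t.1 = 0) with hvs
    have husm : ∀ t ∈ us, t ∈ ts ∧ t.1 ≠ 0 := by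
      intro t ht
      simpa [hus] using ht
    have hvsm : ∀ t ∈ vs, t ∈ ts ∧ t.1 = 0 := by
      intro t ht
      simpa [hvs] using ht
    obtain ⟨C, hC, hCm, hCd, hCs⟩ := ih (us.map fun t => (t.1 - 1, t.2)) (by
        rw [List.pairwise_map]
        refine (h.filter _).imp_of_mem ?_
        intro a b ha hb hab hn
        have h1 := hab hn
        have h2 := (husm a ha).2
        simp only
        omega) (by
        intro t ht
        obtain ⟨u, hu, rfl⟩ := List.mem_map.1 ht
        have h1 := hD u (husm u hu).1
        have h2 := (husm u hu).2
        simp only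
        omega) (by
        intro t ht
        obtain ⟨u, hu, rfl⟩ := List.mem_map.1 ht
        exact hG u (husm u hu).1)
    -- `Layer.matrix` multiplies its list from left to right, whereas `gateProd` puts the first gate
    -- rightmost; hence the reversal.
    refine ⟨⟨(vs.map Prod.snd).reverse, ?_⟩ :: C, ?_, ?_, ?_, ?_⟩
    · rw [List.pairwise_reverse, List.pairwise_map]
      refine (h.filter _).imp_of_mem ?_
      intro a b ha hb hab
      by_contra hn
      have h1 := hab fun hd => hn hd.symm
      have h2 := (hvsm b hb).2
      omega
    · intro L hL
      rcases List.mem_cons.1 hL with rfl | hL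
      · intro g hg
        simp only [List.mem_reverse, List.mem_map] at hg
        obtain ⟨t, ht, rfl⟩ := hg
        exact hG t (hvsm t ht).1
      · exact hC L hL
    · have hrev : ∀ gs : List (Gate Q), (gs.reverse.map Gate.matrix).prod = gateProd gs := by
        intro gs
        induction gs with
        | nil => simp [gateProd]
        | cons g gs ih => simp [gateProd, ← ih]
      rw [gateProd_filter_time ts h, Circuit.matrix, hCm, Layer.matrix, hrev, List.map_map]
      rfl
    · simp only [Circuit.depth, List.length_cons] at hCd ⊢
      rw [hCd]
    · simp only [Circuit.size, List.map_cons, List.sum_cons, List.length_reverse,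
        List.length_map] at hCs ⊢
      rw [hCs, hus, hvs, List.length_eq_length_filter_add (l := ts) fun t => decide (t.1 = 0)]

/-- A scheduled gate list can be arranged as a circuit. -/
theorem Sched.exists_circuit {G : SimpleGraph Q} {S : Set Q} {D : ℕ} {gs : List (Gate Q)}
    (h : Sched G S D gs) :
    ∃ C : Circuit Q, C.Respects G ∧ C.matrix = gateProd gs ∧ C.depth = D ∧
      C.size = gs.length := by
  obtain ⟨ts, rfl, h2, h3⟩ := h.timed
  obtain ⟨C, h4, h5, h6, h7⟩ := exists_circuit_of_timed G D ts h2 h3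
    fun t ht => h.respects t.2 (List.mem_map_of_mem ht)
  exact ⟨C, h4, h5, h6, by simpa using h7⟩

end Scheduling

/-! ### Elementary gates -/

section Gates

/-- The swap of two qubits. -/
noncomputable def swapU : Matrix.unitaryGroup (Bool × Bool) ℂ :=
  ⟨Matrix.of fun c d => if c = d.swap then 1 else 0, by
    rw [Matrix.mem_unitaryGroup_iff']
    ext ⟨a, b⟩ ⟨c, d⟩
    rw [Matrix.mul_apply]
    cases a <;> cases b <;> cases c <;> cases d <;>
      simp⟩

/-- The controlled phase flip. -/
noncomputable def czU : Matrix.unitaryGroup (Bool × Bool) ℂ :=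
  ⟨Matrix.of fun c d => if c = d then (if d.1 && d.2 then -1 else 1) else 0, by
    rw [Matrix.mem_unitaryGroup_iff']
    ext ⟨a, b⟩ ⟨c, d⟩
    rw [Matrix.mul_apply]
    cases a <;> cases b <;> cases c <;> cases d <;>
      simp⟩

/-- The rotation by `θ` in the plane spanned by `|10⟩` and `|01⟩`. -/
noncomputable def rotU (θ : ℝ) : Matrix.unitaryGroup (Bool × Bool) ℂ :=
  ⟨Matrix.of fun c d => if c = d then (if d.1 = d.2 then 1 else (Real.cos θ : ℂ)) else
      if d.1 ≠ d.2 ∧ c = d.swap then (if d.1 then (Real.sin θ : ℂ) else -(Real.sin θ : ℂ)) else 0, by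
    have h : (Real.cos θ : ℂ) * Real.cos θ + Real.sin θ * Real.sin θ = 1 := by
      rw [← Complex.ofReal_mul, ← Complex.ofReal_mul, ← Complex.ofReal_add, ← sq, ← sq,
        Real.cos_sq_add_sin_sq, Complex.ofReal_one]
    have h' : (Real.sin θ : ℂ) * Real.sin θ + Real.cos θ * Real.cos θ = 1 := by
      rw [add_comm, h]
    rw [Matrix.mem_unitaryGroup_iff']
    ext ⟨a, b⟩ ⟨c, d⟩
    rw [Matrix.mul_apply]
    simp only [Matrix.star_apply, Fintype.sum_prod_type, Fintype.sum_bool, Matrix.one_apply]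
    generalize Real.cos θ = C at *
    generalize Real.sin θ = S at *
    cases a <;> cases b <;> cases c <;> cases d <;>
      simp [h, h', mul_comm]⟩

variable {Q : Type} [Fintype Q] [DecidableEq Q]

theorem update_update_swap {Q : Type} [DecidableEq Q] {x y : Q} (hxy : x ≠ y) (s : Bits Q) :
    Function.update (Function.update s x (s y)) y (s x) = s ∘ Equiv.swap x y := by
  ext r
  by_cases hy : r = y
  · subst hy; simp
  · by_cases hx : r = x
    · subst hx; simp [hxy]
    · simp [hx, hy, Equiv.swap_apply_of_ne_of_ne hx hy]

theorem act_swap {x y : Q} (hxy : x ≠ y) (s : Bits Q) :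
    act [Gate.two x y hxy swapU] (basisVec s) = basisVec (s ∘ Equiv.swap x y) := by
  rw [act_two_basisVec, Finset.sum_eq_single (s y, s x)]
  · simp [swapU, update_update_swap hxy]
  · intro c _ hc
    have : ¬ c = (s x, s y).swap := hc
    simp only [swapU, Matrix.of_apply, this, if_false, zero_smul]
  · simp

theorem act_cz {x y : Q} (hxy : x ≠ y) (s : Bits Q) :
    act [Gate.two x y hxy czU] (basisVec s) =
      (if s x && s y then (-1 : ℂ) else 1) • basisVec s := by
  rw [act_two_basisVec, Finset.sum_eq_single (s x, s y)]
  · simp [czU]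
  · intro c _ hc
    simp only [czU, Matrix.of_apply, hc, if_false, zero_smul]
  · simp

/-- The image of a basis vector under the rotation by `θ` on the qubits `x`, `y`. -/
noncomputable def rotVec (x y : Q) (θ : ℝ) (s : Bits Q) : Bits Q → ℂ :=
  if s x = s y then basisVec s else (Real.cos θ : ℂ) • basisVec s +
    (if s x then (Real.sin θ : ℂ) else -(Real.sin θ : ℂ)) • basisVec (s ∘ Equiv.swap x y)

theorem act_rot {x y : Q} (hxy : x ≠ y) (θ : ℝ) (s : Bits Q) :
    act [Gate.two x y hxy (rotU θ)] (basisVec s) = rotVec x y θ s := by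
  have e : Function.update (Function.update s x (s x)) y (s y) = s := by simp
  rw [act_two_basisVec, rotVec]
  split_ifs with h h'
  · rw [Finset.sum_eq_single (s x, s y)]
    · simp only [e]
      simp [rotU, h]
    · intro c _ hc
      have h1 : ¬ ((s x, s y).1 ≠ (s x, s y).2 ∧ c = (s x, s y).swap) := fun h' => h'.1 h
      simp only [rotU, Matrix.of_apply, hc, if_false, h1, zero_smul]
    · simp
  all_goals
    rw [Finset.sum_eq_add (s x, s y) (s y, s x)]
    · have h1 : (rotU θ).1 (s x, s y) (s x, s y) = (Real.cos θ : ℂ) := by simp [rotU, h]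
      have h2 : (rotU θ).1 (s y, s x) (s x, s y) =
          if s x then (Real.sin θ : ℂ) else -(Real.sin θ : ℂ) := by simp [rotU, h, Ne.symm h]
      rw [h1, h2]
      simp only [update_update_swap hxy, e]
      simp only [h', if_true, if_false, Bool.false_eq_true]
    · simp [h]
    · intro c _ hc
      have : ¬ c = (s x, s y).swap := hc.2
      simp only [rotU, Matrix.of_apply, hc.1, this, if_false, and_false, zero_smul]
    · simp
    · simp

/-- `F θ` implements, for every `θ`, the rotation by `θ` on `x`, `y` subject to a condition on the
other qubits. -/
def IsCtrlRot (x y : Q) (P : Bits Q → Prop) (F : ℝ → List (Gate Q)) : Prop :=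
  ∀ θ s, (P s → act (F θ) (basisVec s) = rotVec x y θ s) ∧
    (¬ P s → act (F θ) (basisVec s) = basisVec s)

theorem isCtrlRot_rot {x y : Q} (hxy : x ≠ y) :
    IsCtrlRot x y (fun _ => True) (fun θ => [Gate.two x y hxy (rotU θ)]) :=
  fun θ s => ⟨fun _ => act_rot hxy θ s, fun h => absurd trivial h⟩

/-- Conjugating the second half of a rotation by phase flips yields a further control. -/
theorem act_rot_cz_rot_cz {x y u v : Q} (huv : u ≠ v) {F : ℝ → List (Gate Q)}
    (α β : ℝ) (s : Bits Q)
    (hα : act (F α) (basisVec s) = rotVec x y α s)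
    (hβ : ∀ t, t = s ∨ t = s ∘ Equiv.swap x y → act (F β) (basisVec t) = rotVec x y β t)
    (e : ℝ)
    (hs : s x ≠ s y → (((s ∘ Equiv.swap x y) u && (s ∘ Equiv.swap x y) v) = (s u && s v) ∧ e = 1) ∨
      (((s ∘ Equiv.swap x y) u && (s ∘ Equiv.swap x y) v) = !(s u && s v) ∧ e = -1)) :
    act (F α ++ [Gate.two u v huv czU] ++ F β ++ [Gate.two u v huv czU]) (basisVec s) =
      rotVec x y (α + e * β) s := by
  have hss : (s ∘ Equiv.swap x y) ∘ Equiv.swap x y = s := by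
    ext r; simp
  have hx : (s ∘ Equiv.swap x y) x = s y := by simp
  have hy : (s ∘ Equiv.swap x y) y = s x := by simp
  simp only [act_append, hα]
  generalize hs' : s ∘ Equiv.swap x y = s' at *
  unfold rotVec
  by_cases hxy : s x = s y
  · simp only [hxy, if_true]
    rw [act_cz]
    rw [map_smul, hβ s (Or.inl rfl), rotVec, if_pos hxy, map_smul, act_cz, smul_smul]
    split_ifs <;> simp
  · have h1 := hβ s (Or.inl rfl)
    have h2 := hβ s' (Or.inr rfl)
    simp only [rotVec, hx, hy, hxy, Ne.symm hxy, if_false, hs', hss] at h1 h2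
    have hyx : s y = !s x := by
      revert hxy; cases s x <;> cases s y <;> simp
    simp only [hxy, if_false, map_add, map_smul, act_cz, h1, h2, hs']
    rcases hs hxy with ⟨h, rfl⟩ | ⟨h, rfl⟩
    · simp only [one_mul, h, Real.cos_add, Real.sin_add]
      push_cast
      ext r
      simp only [Pi.add_apply, Pi.smul_apply, smul_eq_mul]
      rw [hyx]
      cases s x <;> cases (s u && s v) <;> simp <;> ring
    · simp only [h, neg_one_mul, ← sub_eq_add_neg, Real.cos_sub, Real.sin_sub]
      push_cast
      ext r
      simp only [Pi.add_apply, Pi.smul_apply, smul_eq_mul]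
      rw [hyx]
      cases s x <;> cases (s u && s v) <;> simp <;> ring

/-- With `z = 0` the phase flips do nothing and the two half rotations add up; with `z = 1`
conjugation by the flip on `y` reverses the second half, which cancels the first. Invariance of `P`
under the swap is needed because the first half rotation already reaches the swapped bitstring. -/
theorem IsCtrlRot.ctrl_zero {x y z : Q} {P : Bits Q → Prop} {F : ℝ → List (Gate Q)}
    (hF : IsCtrlRot x y P F) (hP : ∀ s, P (s ∘ Equiv.swap x y) ↔ P s)
    (hyz : y ≠ z) (hxz : x ≠ z) :
    IsCtrlRot x y (fun s => P s ∧ s z = false) (fun θ => F (θ / 2) ++ [Gate.two y z hyz czU] ++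
      F (θ / 2) ++ [Gate.two y z hyz czU]) := by
  have hz : Equiv.swap x y z = z := Equiv.swap_apply_of_ne_of_ne hxz.symm hyz.symm
  intro θ s
  by_cases h : P s
  · have hβ : ∀ t, t = s ∨ t = s ∘ Equiv.swap x y →
        act (F (θ / 2)) (basisVec t) = rotVec x y (θ / 2) t := by
      rintro t (rfl | rfl)
      exacts [(hF _ _).1 h, (hF _ _).1 ((hP s).2 h)]
    constructor
    · rintro ⟨-, h'⟩
      rw [act_rot_cz_rot_cz hyz _ _ s ((hF _ _).1 h) hβ 1]
      · congr 1; ring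
      · intro _
        left
        simp [hz, h']
    · intro h'
      have h'' : s z = true := by
        simpa [h] using h'
      rw [act_rot_cz_rot_cz hyz _ _ s ((hF _ _).1 h) hβ (-1)]
      · have : θ / 2 + -1 * (θ / 2) = 0 := by ring
        rw [this]
        simp [rotVec]
      · intro hne
        right
        simp only [Function.comp_apply, hz, h'', Bool.and_true, Equiv.swap_apply_right, and_true]
        revert hne; cases s x <;> cases s y <;> simp
  · refine ⟨fun h' => absurd h'.1 h, fun _ => ?_⟩
    simp only [act_append, (hF _ _).2 h, act_cz, map_smul, smul_smul]
    split_ifs <;> simp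

/-- The same cancellation with opposite second half: the halves cancel unless the phase flip, active
when `w = 1`, turns `-(θ / 2)` back into `θ / 2`. -/
theorem IsCtrlRot.ctrl_one {w x y : Q} {P : Bits Q → Prop} {F : ℝ → List (Gate Q)}
    (hF : IsCtrlRot x y P F) (hP : ∀ s, P (s ∘ Equiv.swap x y) ↔ P s)
    (hwx : w ≠ x) (hwy : w ≠ y) :
    IsCtrlRot x y (fun s => P s ∧ s w = true) (fun θ => F (θ / 2) ++ [Gate.two w x hwx czU] ++
      F (-(θ / 2)) ++ [Gate.two w x hwx czU]) := by
  have hw : Equiv.swap x y w = w := Equiv.swap_apply_of_ne_of_ne hwx hwy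
  intro θ s
  by_cases h : P s
  · have hβ : ∀ t, t = s ∨ t = s ∘ Equiv.swap x y →
        act (F (-(θ / 2))) (basisVec t) = rotVec x y (-(θ / 2)) t := by
      rintro t (rfl | rfl)
      exacts [(hF _ _).1 h, (hF _ _).1 ((hP s).2 h)]
    constructor
    · rintro ⟨-, h'⟩
      rw [act_rot_cz_rot_cz hwx _ _ s ((hF _ _).1 h) hβ (-1)]
      · congr 1; ring
      · intro hne
        right
        simp only [Function.comp_apply, hw, h', Bool.true_and, Equiv.swap_apply_left, and_true]
        revert hne; cases s x <;> cases s y <;> simp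
    · intro h'
      have h'' : s w = false := by
        simpa [h] using h'
      rw [act_rot_cz_rot_cz hwx _ _ s ((hF _ _).1 h) hβ 1]
      · have : θ / 2 + 1 * (-(θ / 2)) = 0 := by ring
        rw [this]
        simp [rotVec]
      · intro _
        left
        simp [hw, h'']
  · refine ⟨fun h' => absurd h'.1 h, fun _ => ?_⟩
    simp only [act_append, (hF _ _).2 h, act_cz, map_smul, smul_smul]
    split_ifs <;> simp

end Gates

/-! ### Doubly controlled rotations on a path -/

section Gadget

variable {Q : Type} [Fintype Q] [DecidableEq Q]

theorem Sched.two {Q : Type} {G : SimpleGraph Q} {S : Set Q} {x y : Q} (h : G.Adj x y) (hx : x ∈ S)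
    (hy : y ∈ S) (U : Matrix.unitaryGroup (Bool × Bool) ℂ) :
    Sched G S 1 [Gate.two x y h.ne U] :=
  Sched.single h (by simp [Gate.support, Set.insert_subset_iff, hx, hy])

/-- A rotation on two adjacent qubits `x`, `y`, conditional on `0` at a neighbour `z` of `y` and on
`1` at a neighbour `w` of `x`, where either control may be absent. -/
theorem exists_ctrlRot {G : SimpleGraph Q} {S : Set Q} {x y : Q} (hxy : G.Adj x y) (hx : x ∈ S)
    (hy : y ∈ S) (z w : Option Q) (hz : ∀ r ∈ z, G.Adj y r ∧ r ≠ x ∧ r ∈ S)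
    (hw : ∀ r ∈ w, G.Adj r x ∧ r ≠ y ∧ r ∈ S) :
    ∃ F : ℝ → List (Gate Q), (∀ θ, Sched G S 10 (F θ) ∧ (F θ).length ≤ 10) ∧
      IsCtrlRot x y (fun s => (∀ r ∈ z, s r = false) ∧ ∀ r ∈ w, s r = true) F := by
  have hzs : ∀ s : Bits Q, (∀ r ∈ z, (s ∘ Equiv.swap x y) r = false) ↔ ∀ r ∈ z, s r = false := by
    intro s
    refine forall_congr' fun r => forall_congr' fun hr => ?_
    rw [Function.comp_apply, Equiv.swap_apply_of_ne_of_ne (hz r hr).2.1 (hz r hr).1.ne']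
  -- The control on `z` costs at most four gates. The control on `w` uses this gadget twice with two
  -- further phase flips, so ten gates in total, all along the path `w, x, y, z`.
  obtain ⟨F, hF, hF'⟩ : ∃ F : ℝ → List (Gate Q),
      (∀ θ, Sched G S 4 (F θ) ∧ (F θ).length ≤ 4) ∧
      IsCtrlRot x y (fun s => ∀ r ∈ z, s r = false) F := by
    cases z with
    | none =>
      refine ⟨_, fun θ => ⟨(Sched.two hxy hx hy (rotU θ)).mono subset_rfl (by norm_num), by simp⟩, ?_⟩
      simpa using isCtrlRot_rot hxy.ne
    | some z =>
      obtain ⟨h1, h2, h3⟩ := hz z rfl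
      have := (isCtrlRot_rot hxy.ne).ctrl_zero (fun _ => Iff.rfl) h1.ne h2.symm
      refine ⟨_, fun θ => ⟨?_, ?_⟩, by simpa using this⟩
      · exact (((Sched.two hxy hx hy _).append (Sched.two h1 hy h3 _)).append
          (Sched.two hxy hx hy _)).append (Sched.two h1 hy h3 _)
      · simp
  cases w with
  | none => exact ⟨F, fun θ => ⟨(hF θ).1.mono subset_rfl (by norm_num),
      (hF θ).2.trans (by norm_num)⟩, by simpa using hF'⟩
  | some w =>
    obtain ⟨h1, h2, h3⟩ := hw w rfl
    have := hF'.ctrl_one hzs h1.ne h2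
    refine ⟨fun θ => F (θ / 2) ++ [Gate.two w x h1.ne czU] ++ F (-(θ / 2)) ++
      [Gate.two w x h1.ne czU], fun θ => ⟨?_, ?_⟩, by simpa using this⟩
    · exact ((((hF _).1.append (Sched.two h1 h3 hx _)).append (hF _).1).append
        (Sched.two h1 h3 hx _))
    · have e1 := (hF (θ / 2)).2
      have e2 := (hF (-(θ / 2))).2
      simp only [List.length_append, List.length_cons, List.length_nil]
      omega

end Gadget

/-! ### Swap networks on a path -/

section SwapNetwork

variable {Q : Type} [DecidableEq Q]

/-- The permutation exchanging the cells `x` and `x + 1` of a path for every `x` in a list. -/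
def swapProd (f : ℕ → Q) (X : List ℕ) : Equiv.Perm Q :=
  (X.map fun x => Equiv.swap (f x) (f (x + 1))).prod

/-- The listed cells are at least two apart, so the transpositions are disjoint and each acts as if
it were alone. -/
theorem swapProd_spec {f : ℕ → Q} {m : ℕ} (hf : Set.InjOn f (Set.Iio m)) (X : List ℕ)
    (hX : X.Pairwise fun x y => x + 2 ≤ y) (hm : ∀ x ∈ X, x + 1 < m) :
    (∀ x ∈ X, swapProd f X (f x) = f (x + 1)) ∧ (∀ x ∈ X, swapProd f X (f (x + 1)) = f x) ∧
    (∀ y < m, y ∉ X → (∀ x ∈ X, y ≠ x + 1) → swapProd f X (f y) = f y) ∧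
    (∀ r, (∀ y < m, f y ≠ r) → swapProd f X r = r) := by
  induction X with
  | nil => simp [swapProd]
  | cons x X ih =>
    rw [List.pairwise_cons] at hX
    obtain ⟨h1, h2, h3, h4⟩ := ih hX.2 fun y hy => hm y (by simp [hy])
    have hxm := hm x (by simp)
    have hne : ∀ a < m, ∀ b < m, a ≠ b → f a ≠ f b := fun a ha b hb hab h => hab (hf ha hb h)
    have e : ∀ r, swapProd f (x :: X) r = Equiv.swap (f x) (f (x + 1)) (swapProd f X r) := by
      intro r; simp [swapProd]
    have hfix : ∀ y < m, y ≠ x → y ≠ x + 1 → Equiv.swap (f x) (f (x + 1)) (f y) = f y := by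
      intro y hy hyx hyx'
      exact Equiv.swap_apply_of_ne_of_ne (hne y hy x (by omega) hyx) (hne y hy _ hxm hyx')
    have hxX : ∀ y, y < x + 2 → y ∉ X := fun y hy h => by have := hX.1 y h; omega
    refine ⟨?_, ?_, ?_, ?_⟩
    · intro y hy
      rw [e]
      rcases List.mem_cons.1 hy with rfl | hy
      · rw [h3 y (by omega) (hxX y (by omega)) (fun z hz => by have := hX.1 z hz; omega)]
        simp
      · have := hX.1 y hy
        have := hm y (by simp [hy])
        rw [h1 y hy, hfix _ (by omega) (by omega) (by omega)]
    · intro y hy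
      rw [e]
      rcases List.mem_cons.1 hy with rfl | hy
      · rw [h3 (y + 1) hxm (hxX _ (by omega)) (fun z hz => by have := hX.1 z hz; omega)]
        simp
      · have := hX.1 y hy
        have := hm y (by simp [hy])
        rw [h2 y hy, hfix _ (by omega) (by omega) (by omega)]
    · intro y hy hyX hyX'
      rw [e, h3 y hy (fun h => hyX (by simp [h])) (fun z hz => hyX' z (by simp [hz])),
        hfix y hy (fun h => hyX (by simp [h])) (hyX' x (by simp))]
    · intro r hr
      rw [e, h4 r hr, Equiv.swap_apply_of_ne_of_ne (hr x (by omega)).symm (hr _ hxm).symm]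

/-- The indices `j` of the second register whose line is crossed in step `d` of the wave. -/
def crossings (p q d : ℕ) : List ℕ :=
  (List.range q).filter fun j => j ≤ d ∧ d < p + j

theorem mem_crossings {p q d j : ℕ} : j ∈ crossings p q d ↔ j < q ∧ j ≤ d ∧ d < p + j := by
  simp [crossings]

theorem crossings_pairwise (p q d : ℕ) : (crossings p q d).Pairwise (· < ·) :=
  List.pairwise_lt_range.filter _

/-- The left one of the two cells at which the crossing with line `j` takes place in step `d`. -/
def crossPos (p d j : ℕ) : ℕ := p - 1 + 2 * j - d

/-- The left cells of all crossings of step `d`. -/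
def crossCells (p q d : ℕ) : List ℕ := (crossings p q d).map (crossPos p d)

theorem crossCells_pairwise (p q d : ℕ) :
    (crossCells p q d).Pairwise fun x y => x + 2 ≤ y := by
  rw [crossCells, List.pairwise_map]
  refine (crossings_pairwise p q d).imp_of_mem ?_
  intro a b ha hb hab
  rw [mem_crossings] at ha hb
  unfold crossPos
  omega

theorem crossCells_lt {p q d x : ℕ} (hx : x ∈ crossCells p q d) : x + 1 < p + q := by
  obtain ⟨j, hj, rfl⟩ := List.mem_map.1 hx
  rw [mem_crossings] at hj
  unfold crossPos
  omega

/-- The permutation from cells to lines before step `d`. -/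
def lineAt (f : ℕ → Q) (p q : ℕ) : ℕ → Equiv.Perm Q
  | 0 => 1
  | d + 1 => lineAt f p q d * swapProd f (crossCells p q d)

/-- Trajectories of the swap network: line `i` of the first register waits until step `p - 1 - i`
and then moves right through `q` cells; line `j` of the second waits until step `j` and then moves
left through `p` cells. They cross in step `p - 1 - i + j`, at cells `i + j` and `i + j + 1`.
Truncated subtraction encodes the waiting. -/
theorem lineAt_spec {f : ℕ → Q} {p q : ℕ} (hf : Set.InjOn f (Set.Iio (p + q))) (d : ℕ) :
    (∀ i < p, lineAt f p q d (f (i + min q (d + i + 1 - p))) = f i) ∧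
    (∀ j < q, lineAt f p q d (f (p + j - min p (d - j))) = f (p + j)) ∧
    (∀ r, (∀ y < p + q, f y ≠ r) → lineAt f p q d r = r) := by
  induction d with
  | zero =>
    refine ⟨?_, ?_, ?_⟩
    · intro i hi
      have : i + min q (0 + i + 1 - p) = i := by omega
      rw [this]; rfl
    · intro j hj
      simp [lineAt]
    · intro r _; rfl
  | succ d ih =>
    obtain ⟨i1, i2, i3⟩ := ih
    obtain ⟨h1, h2, h3, h4⟩ := swapProd_spec hf (crossCells p q d) (crossCells_pairwise p q d)
      (fun x hx => crossCells_lt hx)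
    have hmem : ∀ j < q, j ≤ d → d < p + j → p - 1 + 2 * j - d ∈ crossCells p q d :=
      fun j a b c => List.mem_map.2 ⟨j, mem_crossings.2 ⟨a, b, c⟩, rfl⟩
    have hnot : ∀ y, (∀ j < q, j ≤ d → d < p + j → y ≠ p - 1 + 2 * j - d) →
        y ∉ crossCells p q d := by
      intro y hy hm
      obtain ⟨j, hj, rfl⟩ := List.mem_map.1 hm
      rw [mem_crossings] at hj
      exact hy j hj.1 hj.2.1 hj.2.2 rfl
    have hnot' : ∀ y, (∀ j < q, j ≤ d → d < p + j → y ≠ p - 1 + 2 * j - d + 1) →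
        ∀ x ∈ crossCells p q d, y ≠ x + 1 := by
      intro y hy x hm
      obtain ⟨j, hj, rfl⟩ := List.mem_map.1 hm
      rw [mem_crossings] at hj
      exact hy j hj.1 hj.2.1 hj.2.2
    refine ⟨?_, ?_, ?_⟩
    · intro i hi
      rw [lineAt, Equiv.Perm.mul_apply]
      by_cases hc : p ≤ d + i + 1 ∧ d + i + 1 < p + q
      · have hx := hmem (d + i + 1 - p) (by omega) (by omega) (by omega)
        have e1 : i + min q (d + 1 + i + 1 - p) = p - 1 + 2 * (d + i + 1 - p) - d + 1 := by omega
        have e2 : p - 1 + 2 * (d + i + 1 - p) - d = i + min q (d + i + 1 - p) := by omega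
        rw [e1, h2 _ hx, e2, i1 i hi]
      · have e1 : i + min q (d + 1 + i + 1 - p) = i + min q (d + i + 1 - p) := by omega
        rw [e1, h3 _ (by omega) (hnot _ ?_) (hnot' _ ?_), i1 i hi]
        · intro j _ _ _; omega
        · intro j _ _ _; omega
    · intro j hj
      rw [lineAt, Equiv.Perm.mul_apply]
      by_cases hc : j ≤ d ∧ d < p + j
      · have hx := hmem j hj (by omega) (by omega)
        have e1 : p + j - min p (d + 1 - j) = p - 1 + 2 * j - d := by omega
        have e2 : p - 1 + 2 * j - d + 1 = p + j - min p (d - j) := by omega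
        rw [e1, h1 _ hx, e2, i2 j hj]
      · have e1 : p + j - min p (d + 1 - j) = p + j - min p (d - j) := by omega
        rw [e1, h3 _ (by omega) (hnot _ ?_) (hnot' _ ?_), i2 j hj]
        · intro j' _ _ _; omega
        · intro j' _ _ _; omega
    · intro r hr
      rw [lineAt, Equiv.Perm.mul_apply, h4 r hr, i3 r hr]

end SwapNetwork

/-! ### The wave of controlled rotations -/

section Wave

variable {Q : Type} [DecidableEq Q]

/-- The bitstring with ones exactly on `S`. -/
def setBits (S : Finset Q) : Bits Q := fun r => decide (r ∈ S)

/-- Ones on `S`, on the first `α` cells of the first register and on the first `b` cells of the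
second register of a path `f`, the first register having `p` cells. -/
def regSet (f : ℕ → Q) (p : ℕ) (S : Finset Q) (α b : ℕ) : Finset Q :=
  S ∪ (Finset.range α).image f ∪ (Finset.range b).image fun j => f (p + j)

theorem regSet_left {f : ℕ → Q} {p q : ℕ} (hf : Set.InjOn f (Set.Iio (p + q))) {S : Finset Q}
    (hS : ∀ y < p + q, f y ∉ S) {α b i : ℕ} (hα : α ≤ p) (hb : b ≤ q) (hi : i < p) :
    f i ∈ regSet f p S α b ↔ i < α := by
  simp only [regSet, Finset.mem_union, hS i (by omega), Finset.mem_image, Finset.mem_range,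
    false_or]
  constructor
  · rintro (⟨a, ha, h⟩ | ⟨a, ha, h⟩)
    · have := hf (Set.mem_Iio.2 (by omega)) (Set.mem_Iio.2 (by omega)) h
      omega
    · have := hf (Set.mem_Iio.2 (by omega)) (Set.mem_Iio.2 (by omega)) h
      omega
  · exact fun h => Or.inl ⟨i, h, rfl⟩

theorem regSet_right {f : ℕ → Q} {p q : ℕ} (hf : Set.InjOn f (Set.Iio (p + q))) {S : Finset Q}
    (hS : ∀ y < p + q, f y ∉ S) {α b j : ℕ} (hα : α ≤ p) (hb : b ≤ q) (hj : j < q) :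
    f (p + j) ∈ regSet f p S α b ↔ j < b := by
  simp only [regSet, Finset.mem_union, hS (p + j) (by omega), Finset.mem_image, Finset.mem_range,
    false_or]
  constructor
  · rintro (⟨a, ha, h⟩ | ⟨a, ha, h⟩)
    · have := hf (Set.mem_Iio.2 (by omega)) (Set.mem_Iio.2 (by omega)) h
      omega
    · have := hf (Set.mem_Iio.2 (by omega)) (Set.mem_Iio.2 (by omega)) h
      omega
  · exact fun h => Or.inr ⟨j, h, rfl⟩

theorem regSet_outside {f : ℕ → Q} {p q : ℕ} {S : Finset Q}
    {α b : ℕ} (hα : α ≤ p) (hb : b ≤ q) {r : Q} (hr : ∀ y < p + q, f y ≠ r) :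
    r ∈ regSet f p S α b ↔ r ∈ S := by
  simp only [regSet, Finset.mem_union, Finset.mem_image, Finset.mem_range, or_assoc]
  constructor
  · rintro (h | ⟨a, ha, h⟩ | ⟨a, ha, h⟩)
    · exact h
    · exact absurd h (hr _ (by omega))
    · exact absurd h (hr _ (by omega))
  · exact Or.inl

/-- In both registers the ones form an initial segment, so moving a single one from line `i` to line
`p + j` keeps both contents unary. This is why a two-qubit rotation can shift weight between the
registers. -/
theorem setBits_regSet_swap {f : ℕ → Q} {p q : ℕ} (hf : Set.InjOn f (Set.Iio (p + q)))
    {S : Finset Q} (hS : ∀ y < p + q, f y ∉ S) {i j : ℕ} (hi : i < p) (hj : j < q) :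
    setBits (regSet f p S (i + 1) j) ∘ Equiv.swap (f i) (f (p + j)) =
      setBits (regSet f p S i (j + 1)) := by
  ext r
  simp only [setBits, Function.comp_apply, decide_eq_decide]
  have hne : ∀ a < p + q, ∀ b < p + q, a ≠ b → f a ≠ f b := fun a ha b hb hab h => hab (hf ha hb h)
  by_cases hr : ∃ y < p + q, f y = r
  · obtain ⟨y, hy, rfl⟩ := hr
    by_cases h1 : y = i
    · subst h1
      rw [Equiv.swap_apply_left, regSet_right hf hS (by omega) (by omega) hj,
        regSet_left hf hS (by omega) (by omega) hi]
      simp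
    · by_cases h2 : y = p + j
      · subst h2
        rw [Equiv.swap_apply_right, regSet_right hf hS (by omega) (by omega) hj,
          regSet_left hf hS (by omega) (by omega) hi]
        simp
      · rw [Equiv.swap_apply_of_ne_of_ne (hne y hy i (by omega) h1)
          (hne y hy _ (by omega) h2)]
        by_cases h3 : y < p
        · rw [regSet_left hf hS (by omega) (by omega) h3,
            regSet_left hf hS (by omega) (by omega) h3]
          omega
        · obtain ⟨t, rfl⟩ := Nat.exists_eq_add_of_le (not_lt.1 h3)
          rw [regSet_right hf hS (by omega) (by omega) (by omega),
            regSet_right hf hS (by omega) (by omega) (by omega)]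
          omega
  · push Not at hr
    rw [Equiv.swap_apply_of_ne_of_ne (hr i (by omega)).symm (hr _ (by omega)).symm,
      regSet_outside (q := q) (by omega) (by omega) hr,
      regSet_outside (q := q) (by omega) (by omega) hr]

variable [Fintype Q]

/-- The basis state of the register contents `α`, `b` before step `d` of the wave. -/
def waveVec (f : ℕ → Q) (p q : ℕ) (S : Finset Q) (d α b : ℕ) : Bits Q → ℂ :=
  basisVec (setBits (regSet f p S α b) ∘ lineAt f p q d)

/-- After `p + q` steps all lines have crossed, and the registers have exchanged places with their
internal order preserved. -/
theorem waveVec_final {f : ℕ → Q} {p q : ℕ} (hf : Set.InjOn f (Set.Iio (p + q)))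
    {S : Finset Q} (hS : ∀ y < p + q, f y ∉ S) {α b : ℕ} (hα : α ≤ p) (hb : b ≤ q) :
    waveVec f p q S (p + q) α b = basisVec (setBits (S ∪ (Finset.range b).image f ∪
      (Finset.range α).image fun i => f (q + i))) := by
  obtain ⟨h1, h2, h3⟩ := lineAt_spec hf (p + q)
  unfold waveVec
  congr 1
  ext r
  simp only [setBits, Function.comp_apply, decide_eq_decide]
  -- The target is again a pair of registers, now with the `q`-cell register in front.
  change _ ↔ r ∈ regSet f q S b α
  rw [add_comm] at hf hS
  by_cases hr : ∃ y < p + q, f y = r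
  · obtain ⟨y, hy, rfl⟩ := hr
    by_cases hyq : y < q
    · have := h2 y hyq
      have e : p + y - min p (p + q - y) = y := by omega
      rw [e] at this
      rw [this, regSet_left hf hS hb hα hyq]
      rw [add_comm] at hf hS
      rw [regSet_right hf hS hα hb hyq]
    · obtain ⟨i, rfl⟩ := Nat.exists_eq_add_of_le (not_lt.1 hyq)
      have := h1 i (by omega)
      have e : i + min q (p + q + i + 1 - p) = q + i := by omega
      rw [e] at this
      rw [this, regSet_right hf hS hb hα (by omega)]
      rw [add_comm] at hf hS
      rw [regSet_left hf hS hα hb (by omega)]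
  · push Not at hr
    rw [h3 r hr, regSet_outside hα hb hr]
    rw [add_comm] at hr
    rw [regSet_outside hb hα hr]

/-- One crossing of the wave: a rotation between the register contents `(i + 1, j)` and
`(i, j + 1)`. -/
theorem exists_crossing {G : SimpleGraph Q} {f : ℕ → Q} {p q : ℕ}
    (hf : Set.InjOn f (Set.Iio (p + q))) (hG : ∀ y, y + 1 < p + q → G.Adj (f y) (f (y + 1)))
    (d j : ℕ) (hj : j ∈ crossings p q d) (θ : ℝ) :
    ∃ gs : List (Gate Q), Sched G (f '' {y | y < p + q ∧ crossPos p d j ≤ y + 1 ∧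
        y ≤ crossPos p d j + 2}) 10 gs ∧ gs.length ≤ 10 ∧
      ∀ S : Finset Q, (∀ y < p + q, f y ∉ S) → ∀ α ≤ p, ∀ b ≤ q,
        (α + d = p + j → b = j → act gs (waveVec f p q S d α b) =
          (Real.cos θ : ℂ) • waveVec f p q S d α b +
          (Real.sin θ : ℂ) • waveVec f p q S d (α - 1) (b + 1)) ∧
        (¬ (α + d = p + j ∧ b = j) → ¬ (α + d + 1 ≤ p + j ∧ j < b) →
          act gs (waveVec f p q S d α b) = waveVec f p q S d α b) := by
  rw [mem_crossings] at hj
  obtain ⟨hjq, hjd, hdp⟩ := hj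
  obtain ⟨i, hi⟩ : ∃ i, i + d + 1 = p + j := ⟨p + j - 1 - d, by omega⟩
  set x := crossPos p d j with hx
  have hxij : x = i + j := by rw [hx, crossPos]; omega
  obtain ⟨h1, h2, -⟩ := lineAt_spec hf d
  have hne : ∀ a < p + q, ∀ b < p + q, a ≠ b → f a ≠ f b := fun a ha b hb hab h => hab (hf ha hb h)
  have lx : lineAt f p q d (f x) = f i := by
    have := h1 i (by omega)
    rwa [show i + min q (d + i + 1 - p) = x by omega] at this
  have ly : lineAt f p q d (f (x + 1)) = f (p + j) := by
    have := h2 j (by omega)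
    rwa [show p + j - min p (d - j) = x + 1 by omega] at this
  have lz : i + 1 < p → lineAt f p q d (f (x + 2)) = f (i + 1) := by
    intro h
    have := h1 (i + 1) h
    rwa [show i + 1 + min q (d + (i + 1) + 1 - p) = x + 2 by omega] at this
  have lw : 1 ≤ j → lineAt f p q d (f (x - 1)) = f (p + (j - 1)) := by
    intro h
    have := h2 (j - 1) (by omega)
    rwa [show p + (j - 1) - min p (d - (j - 1)) = x - 1 by omega] at this
  -- A control is absent exactly when its line does not exist; then `α ≤ i + 1`, respectively `j ≤
  -- b`, holds automatically.
  set z : Option Q := if i + 1 < p then some (f (x + 2)) else none with hz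
  set w : Option Q := if 1 ≤ j then some (f (x - 1)) else none with hw
  have hzm : ∀ r ∈ z, i + 1 < p ∧ r = f (x + 2) := by
    intro r hr
    by_cases h : i + 1 < p
    · simp [hz, h] at hr
      exact ⟨h, hr.symm⟩
    · simp [hz, h] at hr
  have hwm : ∀ r ∈ w, 1 ≤ j ∧ r = f (x - 1) := by
    intro r hr
    by_cases h : 1 ≤ j
    · simp [hw, h] at hr
      exact ⟨h, hr.symm⟩
    · simp [hw, h] at hr
  obtain ⟨F, hF, hF'⟩ := exists_ctrlRot (G := G) (S := f '' {y | y < p + q ∧ x ≤ y + 1 ∧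
      y ≤ x + 2}) (hG x (by omega)) ⟨x, ⟨by omega, by omega, by omega⟩, rfl⟩
      ⟨x + 1, ⟨by omega, by omega, by omega⟩, rfl⟩ z w (by
        intro r hr
        obtain ⟨h, rfl⟩ := hzm r hr
        exact ⟨hG (x + 1) (by omega), hne _ (by omega) _ (by omega) (by omega),
          x + 2, ⟨by omega, by omega, by omega⟩, rfl⟩) (by
        intro r hr
        obtain ⟨h, rfl⟩ := hwm r hr
        have := hG (x - 1) (by omega)
        rw [show x - 1 + 1 = x by omega] at this
        exact ⟨this, hne _ (by omega) _ (by omega) (by omega),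
          x - 1, ⟨by omega, by omega, by omega⟩, rfl⟩)
  refine ⟨F θ, (hF θ).1, (hF θ).2, ?_⟩
  intro S hS α hα b hb
  obtain ⟨hF1, hF2⟩ := hF' θ (setBits (regSet f p S α b) ∘ lineAt f p q d)
  have bx : (setBits (regSet f p S α b) ∘ lineAt f p q d) (f x) = decide (i < α) := by
    simp only [Function.comp_apply, lx, setBits, regSet_left hf hS hα hb (show i < p by omega)]
  have bY : (setBits (regSet f p S α b) ∘ lineAt f p q d) (f (x + 1)) = decide (j < b) := by
    simp only [Function.comp_apply, ly, setBits, regSet_right hf hS hα hb hjq]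
  constructor
  · intro e1 e2
    have hαi : α = i + 1 := by omega
    subst e2
    rw [waveVec, hF1, rotVec, bx, bY]
    · have c1 : i < α := by omega
      simp only [c1, lt_irrefl, decide_true, decide_false, Bool.true_eq_false, if_false, if_true]
      congr 2
      rw [waveVec, Function.comp_assoc, hαi, Nat.add_sub_cancel,
        ← setBits_regSet_swap hf hS (show i < p by omega) hjq, Function.comp_assoc]
      congr 2
      -- Conjugation by `lineAt` turns the swap of the two cells into the swap of the two lines
      -- crossing there.
      have := Equiv.mul_swap_eq_swap_mul (lineAt f p q d) (f x) (f (x + 1))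
      rw [lx, ly] at this
      rw [← Equiv.Perm.coe_mul, this, Equiv.Perm.coe_mul]
    · constructor
      · intro r hr
        obtain ⟨h, rfl⟩ := hzm r hr
        simp only [Function.comp_apply, lz h, setBits, regSet_left hf hS hα hb h,
          decide_eq_false_iff_not]
        omega
      · intro r hr
        obtain ⟨h, rfl⟩ := hwm r hr
        simp only [Function.comp_apply, lw h, setBits,
          regSet_right hf hS hα hb (show b - 1 < q by omega), decide_eq_true_eq]
        omega
  · intro n1 n2
    rw [waveVec]
    -- If the controls fire, then `α ≤ i + 1` and `j ≤ b`. The two bits can then differ only for `α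
    -- = i + 1`, `b = j` or for `α ≤ i`, `b > j`, and both cases are excluded, so the rotation is
    -- idle.
    by_cases hP : (∀ r ∈ z, (setBits (regSet f p S α b) ∘ lineAt f p q d) r = false) ∧
      ∀ r ∈ w, (setBits (regSet f p S α b) ∘ lineAt f p q d) r = true
    · rw [hF1 hP, rotVec, if_pos]
      rw [bx, bY, decide_eq_decide]
      have c1 : α ≤ i + 1 := by
        by_contra hlt
        have h : i + 1 < p := by omega
        have := hP.1 (f (x + 2)) (by simp [hz, h])
        simp only [Function.comp_apply, lz h, setBits, regSet_left hf hS hα hb h,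
          decide_eq_false_iff_not] at this
        omega
      have c2 : j ≤ b := by
        by_contra hlt
        have h : 1 ≤ j := by omega
        have := hP.2 (f (x - 1)) (by simp [hw, h])
        simp only [Function.comp_apply, lw h, setBits,
          regSet_right hf hS hα hb (show j - 1 < q by omega), decide_eq_true_eq] at this
        omega
      omega
    · exact hF2 hP

end Wave

/-! ### Time steps of the wave and the cascade of amplitudes. -/

section WaveSteps

variable {Q : Type} [DecidableEq Q] [Fintype Q]

/-- The lower bound `lo` serves the induction: it keeps the remaining swaps away from the first
pair, so all of them fit into one time step. -/
theorem exists_swapLayer {G : SimpleGraph Q} {f : ℕ → Q} {m : ℕ}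
    (hf : Set.InjOn f (Set.Iio m)) (hG : ∀ y, y + 1 < m → G.Adj (f y) (f (y + 1)))
    (X : List ℕ) (hX : X.Pairwise fun x y => x + 2 ≤ y) (hm : ∀ x ∈ X, x + 1 < m)
    (lo : ℕ) (hlo : ∀ x ∈ X, lo ≤ x) :
    ∃ gs : List (Gate Q), Sched G (f '' {y | lo ≤ y ∧ y < m}) 1 gs ∧ gs.length = X.length ∧
      ∀ s, act gs (basisVec s) = basisVec (s ∘ swapProd f X) := by
  induction X generalizing lo with
  | nil => exact ⟨[], Sched.nil _ _ _, rfl, fun s => by simp [swapProd]⟩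
  | cons x X ih =>
    rw [List.pairwise_cons] at hX
    obtain ⟨gs, h1, h2, h3⟩ := ih hX.2 (fun y hy => hm y (by simp [hy])) (x + 2) hX.1
    have hadj := hG x (hm x (by simp))
    have hxm := hm x (by simp)
    have hxlo := hlo x (by simp)
    refine ⟨Gate.two (f x) (f (x + 1)) hadj.ne swapU :: gs, ?_, by simp [h2], ?_⟩
    · have h4 : Sched G (f '' {y | y = x ∨ y = x + 1}) 1
          [Gate.two (f x) (f (x + 1)) hadj.ne swapU] :=
        Sched.two hadj (Set.mem_image_of_mem f (Or.inl rfl))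
          (Set.mem_image_of_mem f (Or.inr rfl)) _
      refine (h4.append_disjoint h1 ?_).mono ?_ le_rfl
      · rw [Set.disjoint_left]
        rintro _ ⟨a, ha, rfl⟩ ⟨b, hb, hab⟩
        simp only [Set.mem_ofPred_eq] at ha hb
        have := hf (Set.mem_Iio.2 (by omega)) (Set.mem_Iio.2 (by omega)) hab
        omega
      · rw [← Set.image_union]
        apply Set.image_mono
        intro y hy
        simp only [Set.mem_union, Set.mem_ofPred_eq] at hy ⊢
        omega
    · intro s
      rw [act_cons, act_swap, h3]
      simp [swapProd, Function.comp_assoc, Equiv.Perm.coe_mul]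

/-- A superposition in which the terms below `β` have reached their final amplitudes `c` and the
remaining amplitude `A β` sits on the term `β`. -/
noncomputable def cascade (c A : ℕ → ℝ) (v : ℕ → Bits Q → ℂ) (lo β : ℕ) : Bits Q → ℂ :=
  ∑ b ∈ Finset.Ico lo β, (c b : ℂ) • v b + (A β : ℂ) • v β

/-- The index of the unfinished term of total weight `l` before step `d`. -/
def alive (p q l d : ℕ) : ℕ := max (l - p) (min (min l q) ((l + d + 1 - p) / 2))

/-- For each weight at most one crossing per step is active, and it rotates the unfinished term `j`
into its final amplitude and the new unfinished term `j + 1`. The depth is 10 for the crossings with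
even `j`, 10 for those with odd `j`, and 1 for the swaps. -/
theorem exists_waveStep {G : SimpleGraph Q} {f : ℕ → Q} {p q : ℕ}
    (hf : Set.InjOn f (Set.Iio (p + q))) (hG : ∀ y, y + 1 < p + q → G.Adj (f y) (f (y + 1)))
    (d : ℕ) (θ : ℕ → ℕ → ℝ) :
    ∃ gs : List (Gate Q), Sched G (f '' Set.Iio (p + q)) 21 gs ∧ gs.length ≤ 11 * q ∧
      ∀ S : Finset Q, (∀ y < p + q, f y ∉ S) → ∀ l ≤ p + q, ∀ c A : ℕ → ℝ,
        (∀ b, A b * Real.cos (θ l b) = c b) → (∀ b, A b * Real.sin (θ l b) = A (b + 1)) →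
        act gs (cascade c A (fun b => waveVec f p q S d (l - b) b) (l - p) (alive p q l d)) =
          cascade c A (fun b => waveVec f p q S (d + 1) (l - b) b) (l - p)
            (alive p q l (d + 1)) := by
  have hex : ∀ j, ∃ gs : List (Gate Q), j ∈ crossings p q d →
      Sched G (f '' {y | y < p + q ∧ crossPos p d j ≤ y + 1 ∧
        y ≤ crossPos p d j + 2}) 10 gs ∧ gs.length ≤ 10 ∧
      ∀ S : Finset Q, (∀ y < p + q, f y ∉ S) → ∀ α ≤ p, ∀ b ≤ q,
        (α + d = p + j → b = j → act gs (waveVec f p q S d α b) =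
          (Real.cos (θ (p + 2 * j - d) j) : ℂ) • waveVec f p q S d α b +
          (Real.sin (θ (p + 2 * j - d) j) : ℂ) • waveVec f p q S d (α - 1) (b + 1)) ∧
        (¬ (α + d = p + j ∧ b = j) → ¬ (α + d + 1 ≤ p + j ∧ j < b) →
          act gs (waveVec f p q S d α b) = waveVec f p q S d α b) := by
    intro j
    by_cases hj : j ∈ crossings p q d
    · obtain ⟨gs, h⟩ := exists_crossing hf hG d j hj (θ (p + 2 * j - d) j)
      exact ⟨gs, fun _ => h⟩
    · exact ⟨[], fun h => absurd h hj⟩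
  choose cr hcr using hex
  obtain ⟨sw, hsw1, hsw2, hsw3⟩ := exists_swapLayer hf hG (crossCells p q d)
    (crossCells_pairwise p q d) (fun x hx => crossCells_lt hx) 0 (by simp)
  -- A crossing occupies up to four consecutive cells, and consecutive crossings are two cells
  -- apart; crossings whose indices differ by at least two therefore run in parallel.
  have hsched : ∀ P : ℕ → Bool, (∀ a b, P a = true → P b = true → a < b → a + 2 ≤ b) →
      Sched G (f '' Set.Iio (p + q)) 10 (((crossings p q d).filter P).flatMap cr) := by
    intro P hP
    refine (Sched.flatMap_disjoint ((crossings p q d).filter P)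
      (fun j hj => (hcr j (List.mem_of_mem_filter hj)).1) ?_).mono ?_ le_rfl
    · refine ((crossings_pairwise p q d).filter P).imp_of_mem ?_
      intro a b ha hb hab
      rw [List.mem_filter, mem_crossings] at ha hb
      have h2 := hP a b ha.2 hb.2 hab
      rw [Set.disjoint_left]
      rintro _ ⟨u, hu, rfl⟩ ⟨v, hv, huv⟩
      simp only [Set.mem_ofPred_eq, crossPos] at hu hv
      have := hf (Set.mem_Iio.2 hv.1) (Set.mem_Iio.2 hu.1) huv
      omega
    · refine Set.iUnion₂_subset fun j _ => Set.image_mono fun y hy => hy.1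
  set J := (crossings p q d).filter (fun j => decide (j % 2 = 0)) ++
    (crossings p q d).filter (fun j => !decide (j % 2 = 0)) with hJ
  have hperm : J.Perm (crossings p q d) := List.filter_append_perm _ _
  have hJmem : ∀ j, j ∈ J ↔ j ∈ crossings p q d := fun j => hperm.mem_iff
  have hJnd : J.Nodup := hperm.nodup_iff.2 ((crossings_pairwise p q d).imp fun h => h.ne)
  have hcard : (crossings p q d).length ≤ q :=
    (List.length_filter_le _ _).trans_eq List.length_range
  refine ⟨J.flatMap cr ++ sw, ?_, ?_, ?_⟩
  · rw [hJ, List.flatMap_append]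
    refine ((hsched _ ?_).append (hsched _ ?_)).append (hsw1.mono ?_ le_rfl)
    · intro a b ha hb hab
      simp only [decide_eq_true_eq] at ha hb
      omega
    · intro a b ha hb hab
      simp only [Bool.not_eq_true', decide_eq_false_iff_not] at ha hb
      omega
    · exact Set.image_mono fun y hy => hy.2
  · have h1 : (J.flatMap cr).length ≤ 10 * J.length := by
      rw [List.length_flatMap]
      have : ∀ K : List ℕ, (∀ j ∈ K, (cr j).length ≤ 10) →
          (K.map fun j => (cr j).length).sum ≤ 10 * K.length := by
        intro K
        induction K with
        | nil => simp
        | cons a K ih =>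
          intro h
          have h1 := h a (by simp)
          have h2 := ih fun j hj => h j (by simp [hj])
          simp only [List.map_cons, List.sum_cons, List.length_cons]
          omega
      exact this J fun j hj => (hcr j ((hJmem j).1 hj)).2.1
    rw [List.length_append, hsw2, crossCells, List.length_map]
    have := hperm.length_eq
    omega
  · intro S hS l hl c A hc hA
    -- The crossing with line `j` serves weight `p + 2 * j - d`. For another weight its active
    -- content cannot occur, and the bound on `b` excludes the content `α ≤ i`, `b > j` that the
    -- rotation would move backwards. The slack `+ 2` admits the term created earlier in the same
    -- step.
    have inert : ∀ j ∈ crossings p q d, 2 * j + p ≠ l + d → ∀ b, l - p ≤ b → b ≤ min l q →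
        (2 * b + p ≤ l + d + 2 ∨ b = l - p) →
        act (cr j) (waveVec f p q S d (l - b) b) = waveVec f p q S d (l - b) b := by
      intro j hj hne b h1 h2 h3
      have := (hcr j hj).2.2 S hS (l - b) (by omega) b (by omega)
      rw [mem_crossings] at hj
      exact this.2 (by omega) (by omega)
    have inertCascade : ∀ K : List ℕ, (∀ j ∈ K, j ∈ crossings p q d ∧ 2 * j + p ≠ l + d) →
        ∀ β, l - p ≤ β → β ≤ min l q → (2 * β + p ≤ l + d + 2 ∨ β = l - p) →
        act (K.flatMap cr) (cascade c A (fun b => waveVec f p q S d (l - b) b) (l - p) β) =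
          cascade c A (fun b => waveVec f p q S d (l - b) b) (l - p) β := by
      intro K
      induction K with
      | nil => intros; simp
      | cons j K ih =>
        intro hK β h1 h2 h3
        have hj := hK j (by simp)
        rw [List.flatMap_cons, act_append]
        have : act (cr j) (cascade c A (fun b => waveVec f p q S d (l - b) b) (l - p) β) =
            cascade c A (fun b => waveVec f p q S d (l - b) b) (l - p) β := by
          simp only [cascade, map_add, map_sum, map_smul]
          rw [inert j hj.1 hj.2 β h1 h2 h3]
          congr 1
          refine Finset.sum_congr rfl fun b hb => ?_
          rw [Finset.mem_Ico] at hb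
          rw [inert j hj.1 hj.2 b hb.1 (by omega) (by omega)]
        rw [this, ih (fun i hi => hK i (by simp [hi])) β h1 h2 h3]
    have hswap : ∀ β, act sw (cascade c A (fun b => waveVec f p q S d (l - b) b) (l - p) β) =
        cascade c A (fun b => waveVec f p q S (d + 1) (l - b) b) (l - p) β := by
      intro β
      have : ∀ b, act sw (waveVec f p q S d (l - b) b) = waveVec f p q S (d + 1) (l - b) b := by
        intro b
        rw [waveVec, hsw3, waveVec, Function.comp_assoc, lineAt, Equiv.Perm.coe_mul]
      simp only [cascade, map_add, map_sum, map_smul, this]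
    rw [act_append]
    -- The equation `2 * j + p = l + d` has at most one solution, so all crossings before and after
    -- it in `J` are inert for weight `l`.
    by_cases hact : ∃ j ∈ J, 2 * j + p = l + d
    · obtain ⟨j, hjJ, hjl⟩ := hact
      obtain ⟨K, K', hKK⟩ := List.append_of_mem hjJ
      have hjc := (hJmem j).1 hjJ
      have hjc' := mem_crossings.1 hjc
      have hK : ∀ i ∈ K, i ∈ crossings p q d ∧ 2 * i + p ≠ l + d := by
        intro i hi
        refine ⟨(hJmem i).1 (by simp [hKK, hi]), fun h => ?_⟩
        have : i = j := by omega
        subst this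
        rw [hKK, List.nodup_append] at hJnd
        exact hJnd.2.2 i hi i (by simp) rfl
      have hK' : ∀ i ∈ K', i ∈ crossings p q d ∧ 2 * i + p ≠ l + d := by
        intro i hi
        refine ⟨(hJmem i).1 (by simp [hKK, hi]), fun h => ?_⟩
        have : i = j := by omega
        subst this
        rw [hKK, List.nodup_append, List.nodup_cons] at hJnd
        exact hJnd.2.1.1 hi
      have hal : alive p q l d = j := by unfold alive; omega
      have hal' : alive p q l (d + 1) = j + 1 := by unfold alive; omega
      rw [hal, hal', hKK, List.flatMap_append, List.flatMap_cons, act_append, act_append,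
        inertCascade K hK j (by omega) (by omega) (by omega)]
      have hstep : act (cr j) (cascade c A (fun b => waveVec f p q S d (l - b) b) (l - p) j) =
          cascade c A (fun b => waveVec f p q S d (l - b) b) (l - p) (j + 1) := by
        have hcr' := fun b hb b' hb' => (hcr j hjc).2.2 S hS b hb b' hb'
        simp only [cascade, map_add, map_sum, map_smul]
        rw [(hcr' (l - j) (by omega) j (by omega)).1 (by omega) rfl,
          Finset.sum_Ico_succ_top (by omega), smul_add, smul_smul, smul_smul,
          ← Complex.ofReal_mul, ← Complex.ofReal_mul, show p + 2 * j - d = l by omega, hc, hA,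
          show l - j - 1 = l - (j + 1) by omega, ← add_assoc]
        congr 2
        refine Finset.sum_congr rfl fun b hb => ?_
        rw [Finset.mem_Ico] at hb
        rw [(hcr' (l - b) (by omega) b (by omega)).2 (by omega) (by omega)]
      rw [hstep, inertCascade K' hK' (j + 1) (by omega) (by omega) (by omega), hswap]
    · push Not at hact
      -- A change of the unfinished index would make `(l + d - p) / 2` an active crossing.
      have hal : alive p q l (d + 1) = alive p q l d := by
        by_contra hne
        obtain ⟨j, hj⟩ : ∃ j, 2 * j + p = l + d := by
          refine ⟨(l + d - p) / 2, ?_⟩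
          unfold alive at hne
          omega
        refine hact j ((hJmem j).2 (mem_crossings.2 ?_)) hj
        unfold alive at hne
        omega
      rw [inertCascade J (fun j hj => ⟨(hJmem j).1 hj, hact j hj⟩), hswap, hal]
      all_goals unfold alive; omega

theorem exists_wave {G : SimpleGraph Q} {f : ℕ → Q} {p q : ℕ}
    (hf : Set.InjOn f (Set.Iio (p + q))) (hG : ∀ y, y + 1 < p + q → G.Adj (f y) (f (y + 1)))
    (θ : ℕ → ℕ → ℝ) (D : ℕ) :
    ∃ gs : List (Gate Q), Sched G (f '' Set.Iio (p + q)) (21 * D) gs ∧ gs.length ≤ 11 * q * D ∧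
      ∀ S : Finset Q, (∀ y < p + q, f y ∉ S) → ∀ l ≤ p + q, ∀ c A : ℕ → ℝ,
        (∀ b, A b * Real.cos (θ l b) = c b) → (∀ b, A b * Real.sin (θ l b) = A (b + 1)) →
        act gs (cascade c A (fun b => waveVec f p q S 0 (l - b) b) (l - p) (alive p q l 0)) =
          cascade c A (fun b => waveVec f p q S D (l - b) b) (l - p) (alive p q l D) := by
  induction D with
  | zero => exact ⟨[], Sched.nil _ _ _, by simp, by simp⟩
  | succ D ih =>
    obtain ⟨gs, h1, h2, h3⟩ := ih
    obtain ⟨gs', h1', h2', h3'⟩ := exists_waveStep hf hG D θ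
    refine ⟨gs ++ gs', h1.append h1', ?_, ?_⟩
    · rw [List.length_append, Nat.mul_succ]
      omega
    · intro S hS l hl c A hc hA
      rw [act_append, h3 S hS l hl c A hc hA, h3' S hS l hl c A hc hA]

end WaveSteps

/-! ### Distribution of the Hamming weight over two registers -/

section Amplitudes

/-- The number of subsets of size `l` of a disjoint union of sets with `N` and `M` elements that
have `b` elements in the first part. -/
def splitCount (M N l b : ℕ) : ℕ := if b ≤ l then N.choose b * M.choose (l - b) else 0

/-- The number of those subsets with at least `j` elements in the first part. -/
def tailCount (M N l j : ℕ) : ℕ := ∑ b ∈ Finset.Ico j (l + 1), splitCount M N l b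

theorem tailCount_eq (M N l j : ℕ) :
    tailCount M N l j = splitCount M N l j + tailCount M N l (j + 1) := by
  by_cases h : j < l + 1
  · rw [tailCount, Finset.sum_eq_sum_Ico_succ_bot h, tailCount]
  -- For `j > l` both tails are empty; the guard in `splitCount` matters here, since truncated
  -- subtraction would make `M.choose (l - j)` equal to `1`.
  · rw [tailCount, tailCount, Finset.Ico_eq_empty (by omega), Finset.Ico_eq_empty (by omega),
      splitCount, if_neg (by omega)]
    simp

/-- Vandermonde's identity: the whole tail counts all subsets, so the cascade starts with amplitude
one. -/
theorem tailCount_zero (M N l : ℕ) : tailCount M N l 0 = (M + N).choose l := by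
  rw [add_comm M N, Nat.add_choose_eq, Finset.Nat.sum_antidiagonal_eq_sum_range_succ_mk, tailCount,
    ← Finset.range_eq_Ico]
  refine Finset.sum_congr rfl fun b hb => ?_
  rw [Finset.mem_range] at hb
  rw [splitCount, if_pos (by omega)]

/-- The rotation angle splitting off the part with exactly `j` elements in the first part. -/
noncomputable def splitAngle (M N l j : ℕ) : ℝ :=
  Real.arccos (Real.sqrt (splitCount M N l j / tailCount M N l j))

/-- The square root of a fraction of the subsets of size `l`. -/
noncomputable def splitAmp (M N l x : ℕ) : ℝ := Real.sqrt (x / (M + N).choose l)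

/-- The angle is chosen so that `cos²` is the fraction of the current tail with exactly `j` elements
in the first part. An empty tail forces an empty part, and both sides are zero. -/
theorem splitAmp_mul_cos (M N l j : ℕ) :
    splitAmp M N l (tailCount M N l j) * Real.cos (splitAngle M N l j) =
      splitAmp M N l (splitCount M N l j) := by
  have h := tailCount_eq M N l j
  generalize tailCount M N l (j + 1) = R' at h
  unfold splitAngle
  generalize tailCount M N l j = R at *
  generalize splitCount M N l j = g at *
  have h1 : Real.sqrt ((g : ℝ) / R) ≤ 1 := by
    rw [Real.sqrt_le_one]
    apply div_le_one_of_le₀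
    · exact_mod_cast (by omega : g ≤ R)
    · positivity
  rw [Real.cos_arccos (by linarith [Real.sqrt_nonneg ((g : ℝ) / R)]) h1, splitAmp, splitAmp,
    ← Real.sqrt_mul (by positivity)]
  congr 1
  rcases Nat.eq_zero_or_pos R with hR | hR
  · have : g = 0 := by omega
    simp [hR, this]
  · have : (R : ℝ) ≠ 0 := by positivity
    field_simp

/-- Complementarily, `sin²` is the fraction of the tail that remains for the later values of `j`. -/
theorem splitAmp_mul_sin (M N l j : ℕ) :
    splitAmp M N l (tailCount M N l j) * Real.sin (splitAngle M N l j) =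
      splitAmp M N l (tailCount M N l (j + 1)) := by
  have h := tailCount_eq M N l j
  unfold splitAngle
  generalize tailCount M N l (j + 1) = R' at *
  generalize tailCount M N l j = R at *
  generalize splitCount M N l j = g at *
  have hR' : (R' : ℝ) = R - g := by rw [h]; push_cast; ring
  have h0 : 0 ≤ (R : ℝ) - g := by rw [← hR']; positivity
  rw [Real.sin_arccos, Real.sq_sqrt (by positivity), splitAmp, splitAmp,
    ← Real.sqrt_mul (by positivity)]
  congr 1
  rcases Nat.eq_zero_or_pos R with hR | hR
  · have : R' = 0 := by omega
    simp [hR, this]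
  · have : (R : ℝ) ≠ 0 := by positivity
    rw [hR']
    field_simp

end Amplitudes

/-! ### Weight distribution along a list of adjacent qubits. -/

section Distribution

variable {Q : Type} [DecidableEq Q]

theorem toFinset_take_drop (xs : List Q) (r : Q) (m l : ℕ) (h : m + l ≤ xs.length) :
    ((xs.drop m).take l).toFinset = (Finset.range l).image fun i => xs.getD (m + i) r := by
  ext x
  simp only [List.mem_toFinset, Finset.mem_image, Finset.mem_range]
  rw [List.mem_iff_getElem]
  constructor
  · rintro ⟨i, hi, rfl⟩
    simp only [List.length_take, List.length_drop] at hi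
    refine ⟨i, by omega, ?_⟩
    rw [List.getD_eq_getElem _ _ (by omega)]
    simp
  · rintro ⟨i, hi, rfl⟩
    refine ⟨i, by simp; omega, ?_⟩
    rw [List.getD_eq_getElem _ _ (by omega)]
    simp

variable [Fintype Q]

/-- The basis vector with ones exactly on `S`. -/
def setVec (S : Finset Q) : Bits Q → ℂ := basisVec (setBits S)

/-- Weight distribution: the weight `l` of a unary register is distributed over the two parts of
the path, the amplitudes being those of subsets of a union of sets with `N` and `M` elements. -/
theorem exists_distribution {G : SimpleGraph Q} {xs : List Q} (hnd : xs.Nodup)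
    (hch : xs.IsChain G.Adj) {p q M N k : ℕ} (hlen : xs.length = p + q) (hpos : 0 < p + q)
    (hpk : min k M ≤ p) (hqk : min k N ≤ q) :
    ∃ gs : List (Gate Q), Sched G {r | r ∈ xs} (21 * (p + q)) gs ∧
      gs.length ≤ 11 * q * (p + q) ∧
      ∀ S : Finset Q, (∀ r ∈ xs, r ∉ S) → ∀ l ≤ k, l ≤ p + q → l ≤ M + N →
        act gs (setVec (S ∪ (xs.take l).toFinset)) = ∑ b ∈ Finset.range (l + 1),
          (splitAmp M N l (N.choose b * M.choose (l - b)) : ℂ) •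
            setVec (S ∪ (xs.take b).toFinset ∪ ((xs.drop q).take (l - b)).toFinset) := by
  obtain ⟨r, hr⟩ : ∃ r, r ∈ xs := List.exists_mem_of_length_pos (by omega)
  set f : ℕ → Q := fun i => xs.getD i r with hfdef
  have hfget : ∀ i (h : i < xs.length), f i = xs[i] := fun i h => List.getD_eq_getElem _ _ h
  have hf : Set.InjOn f (Set.Iio (p + q)) := by
    intro a ha b hb hab
    rw [Set.mem_Iio, ← hlen] at ha hb
    rw [hfget a ha, hfget b hb] at hab
    exact (hnd.getElem_inj_iff).1 hab
  have hG : ∀ y, y + 1 < p + q → G.Adj (f y) (f (y + 1)) := by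
    intro y hy
    rw [hfget y (by omega), hfget (y + 1) (by omega)]
    exact List.isChain_iff_getElem.1 hch y (by omega)
  obtain ⟨gs, h1, h2, h3⟩ := exists_wave hf hG (splitAngle M N) (p + q)
  refine ⟨gs, h1.mono ?_ le_rfl, h2, ?_⟩
  · rintro _ ⟨y, hy, rfl⟩
    rw [Set.mem_Iio, ← hlen] at hy
    rw [hfget y hy]
    exact List.getElem_mem hy
  intro S hS l hlk hlpq hlMN
  have hSf : ∀ y < p + q, f y ∉ S := by
    intro y hy
    rw [← hlen] at hy
    rw [hfget y hy]
    exact hS _ (List.getElem_mem hy)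
  have htot : ((M + N).choose l : ℝ) ≠ 0 := by
    exact_mod_cast (Nat.choose_pos hlMN).ne'
  -- Values of `b` that do not fit into the registers have amplitude zero: `l - b > p ≥ min k M`
  -- together with `l - b ≤ k` forces `l - b > M`, and likewise for `N` in `zhigh`.
  have zlow : ∀ b, b < l - p → splitCount M N l b = 0 := by
    intro b hb
    rw [splitCount, if_pos (by omega), Nat.choose_eq_zero_of_lt (by omega : M < l - b), mul_zero]
  have zhigh : ∀ b, min l q < b → splitCount M N l b = 0 := by
    intro b hb
    rw [splitCount]
    split_ifs with h
    · rw [Nat.choose_eq_zero_of_lt (by omega : N < b), zero_mul]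
    · rfl
  have key := h3 S hSf l hlpq (fun b => splitAmp M N l (splitCount M N l b))
    (fun b => splitAmp M N l (tailCount M N l b)) (splitAmp_mul_cos M N l)
    (splitAmp_mul_sin M N l)
  have hal0 : alive p q l 0 = l - p := by unfold alive; omega
  have halD : alive p q l (p + q) = min l q := by unfold alive; omega
  rw [hal0, halD, cascade, cascade, Finset.Ico_self, Finset.sum_empty, zero_add] at key
  have tlow : tailCount M N l (l - p) = (M + N).choose l := by
    rw [← tailCount_zero]
    have : ∀ j ≤ l - p, tailCount M N l j = tailCount M N l 0 := by
      intro j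
      induction j with
      | zero => simp
      | succ j ih =>
        intro h
        rw [← ih (by omega), tailCount_eq M N l j, zlow j (by omega), zero_add]
    exact this _ le_rfl
  -- At the last index the tail is its own first term, so the unfinished amplitude is already final
  -- and joins the sum.
  have thigh : tailCount M N l (min l q) = splitCount M N l (min l q) := by
    rw [tailCount_eq, tailCount, Finset.sum_eq_zero, add_zero]
    intro b hb
    rw [Finset.mem_Ico] at hb
    exact zhigh b (by omega)
  have hstart : waveVec f p q S 0 (l - (l - p)) (l - p) =
      setVec (S ∪ (xs.take l).toFinset) := by
    rw [waveVec, setVec, lineAt, Equiv.Perm.coe_one, Function.comp_id, regSet]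
    congr 2
    rw [Finset.union_assoc]
    congr 1
    have h := toFinset_take_drop xs r 0 l (by omega)
    simp only [List.drop_zero, zero_add] at h
    rw [h]
    ext x
    simp only [Finset.mem_union, Finset.mem_image, Finset.mem_range]
    constructor
    · rintro (⟨a, ha, rfl⟩ | ⟨a, ha, rfl⟩)
      · exact ⟨a, by omega, rfl⟩
      · exact ⟨p + a, by omega, rfl⟩
    · rintro ⟨a, ha, rfl⟩
      by_cases hap : a < p
      · exact Or.inl ⟨a, by omega, rfl⟩
      · exact Or.inr ⟨a - p, by omega, by simp only [hfdef]; congr 1; omega⟩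
  have hend : ∀ b, l - p ≤ b → b ≤ min l q → waveVec f p q S (p + q) (l - b) b =
      setVec (S ∪ (xs.take b).toFinset ∪ ((xs.drop q).take (l - b)).toFinset) := by
    intro b hb1 hb2
    rw [waveVec_final hf hSf (by omega) (by omega), setVec]
    have e1 := toFinset_take_drop xs r 0 b (by omega)
    simp only [List.drop_zero, zero_add] at e1
    rw [e1, toFinset_take_drop xs r q (l - b) (by omega)]
  have hone : splitAmp M N l ((M + N).choose l) = 1 := by
    rw [splitAmp, div_self htot, Real.sqrt_one]
  simp only [tlow, thigh, hstart, hone] at key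
  rw [Complex.ofReal_one, one_smul, ← Finset.sum_Ico_succ_top (by omega) (fun b =>
    (splitAmp M N l (splitCount M N l b) : ℂ) • waveVec f p q S (p + q) (l - b) b)] at key
  rw [key]
  have hsub : Finset.Ico (l - p) (min l q + 1) ⊆ Finset.range (l + 1) := by
    intro b hb
    rw [Finset.mem_Ico] at hb
    rw [Finset.mem_range]
    omega
  have hco : ∀ b ∈ Finset.range (l + 1), splitCount M N l b = N.choose b * M.choose (l - b) := by
    intro b hb
    rw [Finset.mem_range] at hb
    rw [splitCount, if_pos (by omega)]
  rw [← Finset.sum_subset hsub]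
  · refine Finset.sum_congr rfl fun b hb => ?_
    have hb' := hsub hb
    rw [Finset.mem_Ico] at hb
    rw [hend b (by omega) (by omega), hco b hb']
  · intro b hb hb'
    rw [← hco b hb]
    have : splitCount M N l b = 0 := by
      rw [Finset.mem_Ico] at hb'
      by_cases h : b < l - p
      · exact zlow b h
      · exact zhigh b (by omega)
    simp [this, splitAmp]

end Distribution

/-! ### Dicke states on sets of qubits -/

section Dicke

variable {Q : Type} [DecidableEq Q] [Fintype Q]

/-- The Dicke state of weight `l` on `W`, with ones on `S` outside `W`. -/
noncomputable def dickeVec (W S : Finset Q) (l : ℕ) : Bits Q → ℂ :=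
  ∑ X ∈ W.powersetCard l, (((Real.sqrt (W.card.choose l : ℝ))⁻¹ : ℝ) : ℂ) • setVec (S ∪ X)

/-- The gates map the basis states `start l` to the Dicke states of weight `l ≤ k` on `W`. -/
def PreparesDicke (gs : List (Gate Q)) (start : ℕ → Finset Q) (W : Finset Q) (k : ℕ) : Prop :=
  ∀ l ≤ k, l ≤ W.card → ∀ S, Disjoint S W → act gs (setVec (S ∪ start l)) = dickeVec W S l

/-- A subset of a disjoint union is determined by its traces on the two parts; `b` is the size of
the first trace. -/
theorem sum_powersetCard_union {Q : Type} [DecidableEq Q] {E : Type*} [AddCommMonoid E] {W₁ W₂ : Finset Q}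
    (hd : Disjoint W₁ W₂) (l : ℕ) (F : Finset Q → E) :
    ∑ Z ∈ (W₁ ∪ W₂).powersetCard l, F Z = ∑ b ∈ Finset.range (l + 1),
      ∑ X ∈ W₁.powersetCard b, ∑ Y ∈ W₂.powersetCard (l - b), F (X ∪ Y) := by
  simp only [← Finset.sum_product']
  rw [Finset.sum_sigma']
  refine Finset.sum_nbij' (fun Z => ⟨(Z ∩ W₁).card, (Z ∩ W₁, Z ∩ W₂)⟩)
    (fun t => t.2.1 ∪ t.2.2) ?_ ?_ ?_ ?_ ?_
  · intro Z hZ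
    rw [Finset.mem_powersetCard] at hZ
    have h1 : (Z ∩ W₁).card + (Z ∩ W₂).card = l := by
      rw [← Finset.card_union_of_disjoint
        (hd.mono Finset.inter_subset_right Finset.inter_subset_right),
        ← Finset.inter_union_distrib_left, Finset.inter_eq_left.2 hZ.1, hZ.2]
    simp only [Finset.mem_sigma, Finset.mem_range, Finset.mem_product, Finset.mem_powersetCard,
      Finset.inter_subset_right, true_and]
    omega
  · rintro ⟨b, X, Y⟩ h
    simp only [Finset.mem_sigma, Finset.mem_range, Finset.mem_product,
      Finset.mem_powersetCard] at h ⊢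
    obtain ⟨hb, ⟨hX, hXb⟩, hY, hYb⟩ := h
    refine ⟨Finset.union_subset_union hX hY, ?_⟩
    rw [Finset.card_union_of_disjoint (hd.mono hX hY)]
    omega
  · intro Z hZ
    rw [Finset.mem_powersetCard] at hZ
    simp only
    rw [← Finset.inter_union_distrib_left, Finset.inter_eq_left.2 hZ.1]
  · rintro ⟨b, X, Y⟩ h
    simp only [Finset.mem_sigma, Finset.mem_range, Finset.mem_product,
      Finset.mem_powersetCard] at h
    obtain ⟨hb, ⟨hX, hXb⟩, hY, hYb⟩ := h
    have e1 : (X ∪ Y) ∩ W₁ = X := by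
      rw [Finset.union_inter_distrib_right, Finset.inter_eq_left.2 hX,
        Finset.disjoint_iff_inter_eq_empty.1 (hd.symm.mono_left hY), Finset.union_empty]
    have e2 : (X ∪ Y) ∩ W₂ = Y := by
      rw [Finset.union_inter_distrib_right, Finset.inter_eq_left.2 hY,
        Finset.disjoint_iff_inter_eq_empty.1 (hd.mono_left hX), Finset.empty_union]
    simp [e1, e2, hXb]
  · intro Z hZ
    rw [Finset.mem_powersetCard] at hZ
    simp only
    rw [← Finset.inter_union_distrib_left, Finset.inter_eq_left.2 hZ.1]

/-- Distributing the weight over two disjoint sets and preparing Dicke states on both of them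
prepares Dicke states on their union. -/
theorem PreparesDicke.merge {gs gs₁ gs₂ : List (Gate Q)} {start start₁ start₂ : ℕ → Finset Q}
    {W₁ W₂ : Finset Q} {k : ℕ} (hd : Disjoint W₁ W₂)
    (hgs : ∀ S, Disjoint S (W₁ ∪ W₂) → ∀ l ≤ k, l ≤ W₂.card + W₁.card →
      act gs (setVec (S ∪ start l)) = ∑ b ∈ Finset.range (l + 1),
        (splitAmp W₂.card W₁.card l (W₁.card.choose b * W₂.card.choose (l - b)) : ℂ) •
          setVec (S ∪ start₁ b ∪ start₂ (l - b)))
    (h₁ : PreparesDicke gs₁ start₁ W₁ k) (h₂ : PreparesDicke gs₂ start₂ W₂ k)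
    (hi₂ : ∀ l, start₂ l ⊆ W₂) :
    PreparesDicke (gs ++ (gs₁ ++ gs₂)) start (W₁ ∪ W₂) k := by
  intro l hlk hl S hS
  have hcard : (W₁ ∪ W₂).card = W₁.card + W₂.card := Finset.card_union_of_disjoint hd
  rw [Finset.disjoint_union_right] at hS
  rw [act_append, hgs S (Finset.disjoint_union_right.2 hS) l hlk (by omega), map_sum, dickeVec,
    sum_powersetCard_union hd]
  refine Finset.sum_congr rfl fun b hb => ?_
  rw [Finset.mem_range] at hb
  rw [map_smul]
  -- If one part is too small, the amplitude vanishes, and so does the inner sum, which ranges over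
  -- an empty family.
  by_cases hz : W₁.card.choose b * W₂.card.choose (l - b) = 0
  · rw [hz]
    have : ∑ X ∈ W₁.powersetCard b, ∑ Y ∈ W₂.powersetCard (l - b),
        (((Real.sqrt ((W₁ ∪ W₂).card.choose l : ℝ))⁻¹ : ℝ) : ℂ) • setVec (S ∪ (X ∪ Y)) = 0 := by
      rcases mul_eq_zero.1 hz with h | h
      · rw [← Finset.card_powersetCard, Finset.card_eq_zero] at h
        rw [h, Finset.sum_empty]
      · rw [← Finset.card_powersetCard, Finset.card_eq_zero] at h
        simp [h]
    rw [this]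
    simp [splitAmp]
  · have hz1 : W₁.card.choose b ≠ 0 := left_ne_zero_of_mul hz
    have hz2 : W₂.card.choose (l - b) ≠ 0 := right_ne_zero_of_mul hz
    have hb1 : b ≤ W₁.card := by
      by_contra h
      exact hz1 (Nat.choose_eq_zero_of_lt (by omega))
    have hb2 : l - b ≤ W₂.card := by
      by_contra h
      exact hz2 (Nat.choose_eq_zero_of_lt (by omega))
    have e1 : S ∪ start₁ b ∪ start₂ (l - b) = S ∪ start₂ (l - b) ∪ start₁ b := by
      rw [Finset.union_assoc, Finset.union_comm (start₁ b), ← Finset.union_assoc]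
    rw [act_append, e1, h₁ b (by omega) hb1 (S ∪ start₂ (l - b)) (Finset.disjoint_union_left.2
      ⟨hS.1, (hd.mono_right (hi₂ _)).symm⟩), dickeVec, map_sum, Finset.smul_sum]
    refine Finset.sum_congr rfl fun X hX => ?_
    rw [Finset.mem_powersetCard] at hX
    have e2 : S ∪ start₂ (l - b) ∪ X = S ∪ X ∪ start₂ (l - b) := by
      rw [Finset.union_assoc, Finset.union_comm (start₂ _), ← Finset.union_assoc]
    rw [map_smul, e2, h₂ (l - b) (by omega) hb2 (S ∪ X) (Finset.disjoint_union_left.2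
      ⟨hS.2, hd.mono_left hX.1⟩), dickeVec, smul_smul, Finset.smul_sum]
    refine Finset.sum_congr rfl fun Y _ => ?_
    rw [smul_smul, Finset.union_assoc, ← Complex.ofReal_mul, ← Complex.ofReal_mul]
    congr 2
    have p1 : (0 : ℝ) < W₁.card.choose b := by exact_mod_cast Nat.pos_of_ne_zero hz1
    have p2 : (0 : ℝ) < W₂.card.choose (l - b) := by exact_mod_cast Nat.pos_of_ne_zero hz2
    -- The Vandermonde amplitude cancels the two normalisations and leaves that of the union.
    rw [splitAmp, hcard, add_comm W₂.card]
    push_cast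
    rw [Real.sqrt_div (by positivity), Real.sqrt_mul p1.le]
    have s1 : Real.sqrt (W₁.card.choose b) ≠ 0 := (Real.sqrt_pos.2 p1).ne'
    have s2 : Real.sqrt (W₂.card.choose (l - b)) ≠ 0 := (Real.sqrt_pos.2 p2).ne'
    field_simp

end Dicke

/-! ### Dicke states on paths and combs -/

section Paths

variable {Q : Type} [DecidableEq Q] [Fintype Q]

theorem PreparesDicke.congr {gs : List (Gate Q)} {start start' : ℕ → Finset Q} {W : Finset Q} {k : ℕ}
    (h : PreparesDicke gs start W k) (hi : ∀ l ≤ k, start l = start' l) :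
    PreparesDicke gs start' W k := by
  intro l hlk hl S hS
  rw [← hi l hlk, h l hlk hl S hS]

/-- Dicke states on a union of two sets from Dicke states on its parts, by a weight distribution
along a path through the two unary registers. -/
theorem PreparesDicke.exists_merge {G : SimpleGraph Q} {xs : List Q} (hnd : xs.Nodup)
    (hch : xs.IsChain G.Adj) {p q k : ℕ} {W₁ W₂ : Finset Q} (hd : Disjoint W₁ W₂)
    (hlen : xs.length = p + q) (hpos : 0 < p + q) (hp : min k W₂.card ≤ p)
    (hq : min k W₁.card ≤ q) {start start₁ start₂ : ℕ → Finset Q}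
    (h : ∀ l ≤ p + q, start l = (xs.take l).toFinset)
    (h₁ : ∀ b ≤ q, start₁ b = (xs.take b).toFinset)
    (h₂ : ∀ b ≤ p, start₂ b = ((xs.drop q).take b).toFinset)
    (hsub : ∀ r ∈ xs, r ∈ W₁ ∪ W₂) (hi₂ : ∀ l, start₂ l ⊆ W₂) {gs₁ gs₂ : List (Gate Q)}
    (hgs₁ : PreparesDicke gs₁ start₁ W₁ k) (hgs₂ : PreparesDicke gs₂ start₂ W₂ k) :
    ∃ gs : List (Gate Q), Sched G {r | r ∈ xs} (21 * (p + q)) gs ∧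
      gs.length ≤ 11 * q * (p + q) ∧ PreparesDicke (gs ++ (gs₁ ++ gs₂)) start (W₁ ∪ W₂) k := by
  obtain ⟨gs, g1, g2, g3⟩ := exists_distribution hnd hch hlen hpos hp hq
  refine ⟨gs, g1, g2, PreparesDicke.merge hd ?_ hgs₁ hgs₂ hi₂⟩
  intro S hS l hlk hl
  rw [h l (by omega), g3 S (fun r hr hrS => Finset.disjoint_left.1 hS hrS (hsub r hr)) l hlk
    (by omega) hl]
  refine Finset.sum_congr rfl fun b hb => ?_
  rw [Finset.mem_range] at hb
  -- The registers are known to be unary only up to `q` and `p` ones; a nonzero amplitude guarantees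
  -- that `b` and `l - b` stay within these bounds.
  by_cases hz : W₁.card.choose b * W₂.card.choose (l - b) = 0
  · simp [hz, splitAmp]
  · have hb1 : b ≤ W₁.card := by
      by_contra h
      exact hz (by rw [Nat.choose_eq_zero_of_lt (by omega), zero_mul])
    have hb2 : l - b ≤ W₂.card := by
      by_contra h
      exact hz (by rw [Nat.choose_eq_zero_of_lt (n := W₂.card) (by omega), mul_zero])
    rw [h₁ b (by omega), h₂ (l - b) (by omega)]

/-- On at most one qubit the unary state is already the Dicke state. -/
theorem preparesDicke_nil (xs : List Q) (hxs : xs.length ≤ 1) (k : ℕ) :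
    PreparesDicke [] (fun l => (xs.take l).toFinset) xs.toFinset k := by
  intro l _ hl S _
  have hc : xs.toFinset.card ≤ xs.length := List.toFinset_card_le xs
  rw [act_nil, dickeVec]
  rcases Nat.eq_zero_or_pos l with rfl | hpos
  · simp
  · have e1 : l = xs.toFinset.card := by omega
    have e2 : xs.take l = xs := List.take_of_length_le (by omega)
    simp only [e2]
    rw [e1, Finset.powersetCard_self, Finset.sum_singleton, Nat.choose_self]
    simp

/-- Dicke states along a path in linear depth. -/
theorem exists_pathDicke {G : SimpleGraph Q} {k : ℕ} (hk : 1 ≤ k) (xs : List Q)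
    (hnd : xs.Nodup) (hch : xs.IsChain G.Adj) :
    ∃ gs : List (Gate Q), Sched G {r | r ∈ xs} (63 * xs.length) gs ∧
      gs.length ≤ 11 * (xs.length * xs.length) ∧ gs.length ≤ 33 * (k * xs.length) ∧
      PreparesDicke gs (fun l => (xs.take l).toFinset) xs.toFinset k := by
  induction hL : xs.length using Nat.strong_induction_on generalizing xs with
  | _ L ih =>
  by_cases hL1 : L ≤ 1
  · exact ⟨[], Sched.nil _ _ _, by simp, by simp, preparesDicke_nil xs (by omega) k⟩
  -- At most `k` cells are split off, and at most `k` cells of the remainder serve as its register.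
  -- Since `p ≤ 2 * q`, the distribution depth `21 * (p + q)` is at most `63 * q`, exactly what the
  -- shorter remainder saves.
  · obtain ⟨q, hq⟩ : ∃ q, q = min k (L / 2) := ⟨_, rfl⟩
    obtain ⟨p, hp⟩ : ∃ p, p = min k (L - q) := ⟨_, rfl⟩
    have htd : xs.take q ++ xs.drop q = xs := List.take_append_drop q xs
    have hl1 : (xs.take q).length = q := by rw [List.length_take]; omega
    have hl2 : (xs.drop q).length = L - q := by rw [List.length_drop]; omega
    have hnd' := hnd
    have hch' := hch
    rw [← htd, List.nodup_append'] at hnd'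
    rw [← htd, List.isChain_append] at hch'
    obtain ⟨gs₁, a1, a2, a3, a4⟩ := ih q (by omega) (xs.take q) hnd'.1 hch'.1 hl1
    obtain ⟨gs₂, b1, b2, b3, b4⟩ := ih (L - q) (by omega) (xs.drop q) hnd'.2.1 hch'.2.1 hl2
    have hdl : List.Disjoint (xs.take q) (xs.drop q) := hnd'.2.2
    have hd : Disjoint (xs.take q).toFinset (xs.drop q).toFinset :=
      List.disjoint_toFinset_iff_disjoint.2 hdl
    have hW : (xs.take q).toFinset ∪ (xs.drop q).toFinset = xs.toFinset := by
      rw [← List.toFinset_append, htd]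
    have hc1 : (xs.take q).toFinset.card = q := by
      rw [List.toFinset_card_of_nodup hnd'.1, hl1]
    have hc2 : (xs.drop q).toFinset.card = L - q := by
      rw [List.toFinset_card_of_nodup hnd'.2.1, hl2]
    obtain ⟨gs, c1, c2, c3⟩ := PreparesDicke.exists_merge (G := G) (xs := xs.take (p + q)) (p := p)
      (q := q) (k := k) (start := fun l => (xs.take l).toFinset)
      (hnd.sublist (List.take_sublist _ _)) (hch.take _) hd (by rw [List.length_take]; omega)
      (by omega) (by omega) (by omega)
      (fun l hl => by rw [List.take_take, min_eq_left hl])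
      (fun b hb => by simp only [List.take_take]; rw [min_eq_left hb, min_eq_left (by omega)])
      (fun b hb => by
        rw [List.drop_take, Nat.add_sub_cancel, List.take_take, min_eq_left hb])
      (fun r hr => by rw [hW, List.mem_toFinset]; exact List.mem_of_mem_take hr)
      (fun l r hr => by
        rw [List.mem_toFinset] at hr ⊢
        exact List.mem_of_mem_take hr) a4 b4
    rw [hW] at c3
    have hlen : gs.length + (gs₁.length + gs₂.length) = (gs ++ (gs₁ ++ gs₂)).length := by
      simp only [List.length_append]
    have hqp : q ≤ p := by omega
    -- With `m = L - q` and `q ≤ p ≤ m`, this is `q² + m² + 2qm = L²`.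
    have hsq : gs.length + (gs₁.length + gs₂.length) ≤ 11 * (L * L) := by
      obtain ⟨m, hm⟩ : ∃ m, L = q + m := ⟨L - q, by omega⟩
      rw [hm, Nat.add_sub_cancel_left] at b2
      have h1 : q * (p + q) ≤ q * (m + m) := Nat.mul_le_mul_left _ (by omega)
      rw [hm]
      nlinarith
    refine ⟨_, ?_, ?_, ?_, c3⟩
    · have hpar := (a1.mono subset_rfl (by omega : 63 * q ≤ 63 * (L - q))).append_disjoint b1
        (Set.disjoint_left.2 fun r h1 h2 => hdl h1 h2)
      refine ((c1.mono ?_ le_rfl).append (hpar.mono ?_ le_rfl)).mono subset_rfl ?_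
      · intro r hr
        exact List.mem_of_mem_take hr
      · rintro r (hr | hr)
        exacts [List.mem_of_mem_take hr, List.mem_of_mem_drop hr]
      · omega
    · rw [← hlen]
      exact hsq
    · rw [← hlen]
      -- Up to length `2k` the quadratic bound suffices. Beyond it, the distribution costs `22k²`
      -- and the split-off piece `11k²`, together the share `33k · k` of `k` cells.
      by_cases h2k : L ≤ 2 * k
      · have := Nat.mul_le_mul_right L h2k
        rw [mul_assoc] at this
        omega
      · have e1 : q = k := by omega
        have e2 : p = k := by omega
        rw [e1] at a2 c2 b3
        rw [e2] at c2
        obtain ⟨m, hm⟩ : ∃ m, L = k + m := ⟨L - k, by omega⟩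
        rw [hm, Nat.add_sub_cancel_left] at b3
        rw [hm]
        nlinarith

/-- Dicke states on a comb: paths `s.1 ++ s.2` whose initial segments `s.1` are joined to a path. -/
theorem exists_combDicke {G : SimpleGraph Q} {k B L : ℕ} (hk : 1 ≤ k)
    (strips : List (List Q × List Q)) (hne : strips ≠ [])
    (hnd : (strips.flatMap fun s => s.1 ++ s.2).Nodup)
    (hch : ∀ s ∈ strips, (s.1 ++ s.2).IsChain G.Adj)
    (hcol : (strips.flatMap Prod.fst).IsChain G.Adj)
    (hB : ∀ s ∈ strips, k ≤ s.1.length ∧ s.1.length ≤ B)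
    (hL : ∀ s ∈ strips, (s.1 ++ s.2).length ≤ L) :
    ∃ gs : List (Gate Q),
      Sched G {r | r ∈ strips.flatMap fun s => s.1 ++ s.2} (42 * B * strips.length + 63 * L) gs ∧
      gs.length ≤ 22 * (B * B) * strips.length +
        33 * (k * (strips.flatMap fun s => s.1 ++ s.2).length) ∧
      PreparesDicke gs (fun l => ((strips.flatMap Prod.fst).take l).toFinset)
        (strips.flatMap fun s => s.1 ++ s.2).toFinset k := by
  induction strips with
  | nil => exact absurd rfl hne
  | cons s strips ih =>
    have hsB := hB s (by simp)
    have hsL := hL s (by simp)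
    rw [List.flatMap_cons, List.nodup_append'] at hnd
    obtain ⟨gs₁, a1, -, a3, a4⟩ := exists_pathDicke (G := G) hk (s.1 ++ s.2) hnd.1
      (hch s (by simp))
    have htake : ∀ (ys : List Q) b, b ≤ s.1.length → (s.1 ++ ys).take b = s.1.take b :=
      fun ys b hb => List.take_append_of_le_length hb
    cases strips with
    | nil =>
      simp only [List.flatMap_cons, List.flatMap_nil, List.append_nil, List.length_singleton]
      refine ⟨gs₁, a1.mono subset_rfl ?_, a3.trans (Nat.le_add_left _ _), a4.congr ?_⟩
      · have := Nat.mul_le_mul_left 63 hsL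
        omega
      · intro l hl
        rw [htake _ l (by omega)]
    | cons s' strips =>
      have hs'B := hB s' (by simp)
      obtain ⟨gs₂, b1, b2, b3⟩ := ih (by simp) hnd.2.1 (fun t ht => hch t (by simp [ht]))
        (by
          rw [List.flatMap_cons, List.isChain_append] at hcol
          exact hcol.2.1) (fun t ht => hB t (by simp [ht])) (fun t ht => hL t (by simp [ht]))
      set T := (s' :: strips).flatMap fun s => s.1 ++ s.2 with hT
      have hdl : List.Disjoint (s.1 ++ s.2) T := hnd.2.2
      have hd : Disjoint (s.1 ++ s.2).toFinset T.toFinset :=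
        List.disjoint_toFinset_iff_disjoint.2 hdl
      have hs'T : ∀ r ∈ s'.1, r ∈ T := fun r hr => by simp [hT, hr]
      have hcolT : ∀ r ∈ (s' :: strips).flatMap Prod.fst, r ∈ T := by
        intro r hr
        rw [List.mem_flatMap] at hr
        obtain ⟨t, ht, hr⟩ := hr
        exact List.mem_flatMap.2 ⟨t, ht, by simp [hr]⟩
      have e0 : (s :: s' :: strips).flatMap Prod.fst =
          (s.1 ++ s'.1) ++ strips.flatMap Prod.fst := by simp
      have hndx : (s.1 ++ s'.1).Nodup := by
        rw [List.nodup_append']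
        refine ⟨(List.nodup_append'.1 hnd.1).1, ?_, ?_⟩
        · have := hnd.2.1
          rw [hT, List.flatMap_cons, List.nodup_append', List.nodup_append'] at this
          exact this.1.1
        · intro r h1 h2
          exact hdl (by simp [h1]) (hs'T r h2)
      have hchx : (s.1 ++ s'.1).IsChain G.Adj := by
        rw [e0, List.isChain_append] at hcol
        exact hcol.1
      have hc1 : (s.1 ++ s.2).toFinset.card = (s.1 ++ s.2).length :=
        List.toFinset_card_of_nodup hnd.1
      -- The weight is distributed between the first strip and all the others, using only the first
      -- two spine blocks; each holds at least `k` cells and so can store any weight in question.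
      obtain ⟨gs, c1, c2, c3⟩ := PreparesDicke.exists_merge (G := G) (xs := s.1 ++ s'.1)
        (p := s'.1.length) (q := s.1.length) (k := k)
        (start := fun l => (((s :: s' :: strips).flatMap Prod.fst).take l).toFinset) hndx hchx hd
        (by rw [List.length_append, add_comm]) (by omega) (by omega) (by omega)
        (fun l hl => by
          rw [e0, List.take_append_of_le_length (by rw [List.length_append]; omega)])
        (fun b hb => by rw [htake _ b hb, htake _ b hb])
        (fun b hb => by
          rw [List.drop_left, List.flatMap_cons, List.take_append_of_le_length hb])
        (fun r hr => by
          rw [Finset.mem_union, List.mem_toFinset, List.mem_toFinset]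
          rcases List.mem_append.1 hr with hr | hr
          exacts [Or.inl (by simp [hr]), Or.inr (hs'T r hr)])
        (fun l r hr => by
          rw [List.mem_toFinset] at hr ⊢
          exact hcolT r (List.mem_of_mem_take hr)) a4 b3
      rw [← List.toFinset_append] at c3
      have hall : (s :: s' :: strips).flatMap (fun s => s.1 ++ s.2) = (s.1 ++ s.2) ++ T := by
        rw [hT, List.flatMap_cons]
      rw [hall]
      refine ⟨_, ?_, ?_, c3⟩
      -- Once it has its share, the first strip works in parallel with the rest of the comb, so each
      -- further strip adds only one distribution, of depth at most `42 * B`.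
      · have hpar := (a1.mono subset_rfl (show _ ≤ 42 * B * (s' :: strips).length + 63 * L by
            have := Nat.mul_le_mul_left 63 hsL
            omega)).append_disjoint b1 (Set.disjoint_left.2 fun r h1 h2 => hdl h1 h2)
        refine ((c1.mono ?_ le_rfl).append (hpar.mono ?_ le_rfl)).mono subset_rfl ?_
        · intro r hr
          rcases List.mem_append.1 hr with hr | hr
          · exact List.mem_append.2 (Or.inl (by simp [hr]))
          · exact List.mem_append.2 (Or.inr (hs'T r hr))
        · rintro r (hr | hr)
          exacts [List.mem_append.2 (Or.inl hr), List.mem_append.2 (Or.inr hr)]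
        · rw [List.length_cons (a := s), Nat.mul_succ]
          omega
      · have h1 : s.1.length * (s'.1.length + s.1.length) ≤ B * (B + B) :=
          Nat.mul_le_mul hsB.2 (by omega)
        rw [List.length_append, List.length_append, List.length_append, List.length_cons (a := s)]
        nlinarith

end Paths

/-! ### Placing the qubits -/

section Placement

/-- Unitarity is automatic for a product of gates, and the amplitude of `x` in `dickeVec` comes only
from the set of ones of `x`. -/
theorem isDickeUnitary_of_preparesDicke {n k : ℕ} (hkn : k ≤ n) {gs : List (Gate (Fin n))}
    {start : ℕ → Finset (Fin n)} (h : PreparesDicke gs start Finset.univ k)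
    (hi : ∀ l ≤ k, ∀ i, i ∈ start l ↔ i.val < l) : IsDickeUnitary n k (gateProd gs) := by
  refine ⟨gateProd_mem_unitaryGroup gs, fun l hl => ?_⟩
  have h1 := h l hl (by rw [Finset.card_univ, Fintype.card_fin]; omega) ∅
    (Finset.disjoint_empty_left _)
  have h2 : setVec (∅ ∪ start l) = ket (unaryBits n l) := by
    rw [Finset.empty_union, setVec, basisVec, ket]
    congr 1
    ext i
    simp only [setBits, unaryBits, hi l hl i]
  rw [h2] at h1
  rw [← Matrix.mulVecLin_apply]
  refine Eq.trans h1 ?_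
  ext x
  simp only [dickeVec, Finset.sum_apply, Pi.smul_apply, smul_eq_mul, Finset.empty_union, dickeState,
    Finset.card_univ, Fintype.card_fin, setVec, basisVec]
  set X : Finset (Fin n) := Finset.univ.filter fun i => x i = true with hX
  have hXx : setBits X = x := by
    ext i
    simp [setBits, hX]
  have hne : ∀ Y : Finset (Fin n), Y ≠ X → (Pi.single (setBits Y) 1 : Bits (Fin n) → ℂ) x = 0 := by
    intro Y hY
    apply Pi.single_eq_of_ne
    rintro rfl
    apply hY
    ext i
    simp [hX, setBits]
  have hw : hammingWeight x = X.card := rfl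
  split_ifs with hl'
  · rw [Finset.sum_eq_single X]
    · rw [hXx]; simp
    · intro Y _ hY
      rw [hne Y hY, mul_zero]
    · intro hX'
      exact absurd (Finset.mem_powersetCard.2 ⟨Finset.subset_univ _, hl'⟩) hX'
  · apply Finset.sum_eq_zero
    intro Y hY
    rw [hne Y, mul_zero]
    rintro rfl
    exact hl' (Finset.mem_powersetCard.1 hY).2

/-- Qubits are numbered in the order of `cells`; the left inverse `inv` carries paths of sites over
to paths of qubits. -/
theorem exists_placement {V : Type*} (cells : List V) (hnd : cells.Nodup) (hpos : 0 < cells.length) :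
    ∃ (place : Fin cells.length ↪ V) (inv : V → Fin cells.length),
      (∀ v ∈ cells, place (inv v) = v) ∧ (∀ i, place i ∈ cells) ∧ (∀ i, inv (place i) = i) ∧
      cells.map inv = List.finRange cells.length := by
  classical
  have hinj : Function.Injective cells.get := hnd.injective_get
  have : Nonempty (Fin cells.length) := ⟨⟨0, hpos⟩⟩
  have hinv : ∀ i, Function.invFun cells.get (cells.get i) = i :=
    fun i => Function.leftInverse_invFun hinj i
  refine ⟨⟨cells.get, hinj⟩, Function.invFun cells.get, ?_, ?_, hinv, ?_⟩
  · intro v hv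
    obtain ⟨i, rfl⟩ := List.get_of_mem hv
    simp only [Function.Embedding.coeFn_mk, hinv]
  · intro i
    exact List.get_mem _ _
  · apply List.ext_get
    · simp
    · intro i h1 h2
      rw [List.length_map] at h1
      have := hinv ⟨i, h1⟩
      rw [List.get_eq_getElem] at this
      simp [this]

/-- Numbering the spine cells before all others places the ones of `0^(n-l) 1^l` on the first `l`
spine cells, which is where `exists_combDicke` expects its input. -/
theorem exists_circuit_of_comb {V : Type*} (H : SimpleGraph V) {n k B L : ℕ} (hk : 1 ≤ k)
    (strips : List (List V × List V)) (hne : strips ≠ [])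
    (hnd : (strips.flatMap fun s => s.1 ++ s.2).Nodup)
    (hch : ∀ s ∈ strips, (s.1 ++ s.2).IsChain H.Adj)
    (hcol : (strips.flatMap Prod.fst).IsChain H.Adj)
    (hB : ∀ s ∈ strips, k ≤ s.1.length ∧ s.1.length ≤ B)
    (hL : ∀ s ∈ strips, (s.1 ++ s.2).length ≤ L)
    (hn : (strips.flatMap fun s => s.1 ++ s.2).length = n) :
    ∃ (place : Fin n ↪ V) (circ : Circuit (Fin n)), circ.Respects (H.comap place) ∧
      IsDickeUnitary n k circ.matrix ∧ circ.depth = 42 * B * strips.length + 63 * L ∧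
      circ.size ≤ 22 * (B * B) * strips.length + 33 * (k * n) ∧
      ∀ i, place i ∈ strips.flatMap fun s => s.1 ++ s.2 := by
  set cells := strips.flatMap Prod.fst ++ strips.flatMap Prod.snd with hcells
  have hperm : cells.Perm (strips.flatMap fun s => s.1 ++ s.2) :=
    List.flatMap_append_perm strips Prod.fst Prod.snd
  have hlen : cells.length = n := hperm.length_eq.trans hn
  subst hlen
  have hkcol : k ≤ (strips.flatMap Prod.fst).length := by
    obtain ⟨s, hs⟩ := List.exists_mem_of_ne_nil strips hne
    have h1 := (hB s hs).1
    have h2 : s.1.length ≤ (strips.flatMap Prod.fst).length := by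
      rw [List.length_flatMap]
      exact List.single_le_sum (by simp) _ (List.mem_map.2 ⟨s, hs, rfl⟩)
    omega
  have hkn : k ≤ cells.length := by
    rw [hcells, List.length_append]; omega
  obtain ⟨place, inv, h1, h2, h3, h4⟩ := exists_placement cells (hperm.nodup_iff.2 hnd) (by omega)
  have hmem : ∀ s ∈ strips, ∀ v ∈ s.1 ++ s.2, v ∈ cells := fun s hs v hv =>
    hperm.mem_iff.2 (List.mem_flatMap.2 ⟨s, hs, hv⟩)
  have hchain : ∀ l : List V, (∀ v ∈ l, v ∈ cells) → l.IsChain H.Adj →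
      (l.map inv).IsChain (H.comap place).Adj := by
    intro l hl hc
    rw [List.isChain_map]
    refine hc.imp_of_mem_imp ?_
    intro a b ha hb hab
    rw [SimpleGraph.comap_adj, h1 a (hl a ha), h1 b (hl b hb)]
    exact hab
  have e1 : (strips.map fun s => (s.1.map inv, s.2.map inv)).flatMap (fun s => s.1 ++ s.2) =
      (strips.flatMap fun s => s.1 ++ s.2).map inv := by
    rw [List.flatMap_map, List.map_flatMap]
    simp only [List.map_append]
  have e2 : (strips.map fun s => (s.1.map inv, s.2.map inv)).flatMap Prod.fst =
      (strips.flatMap Prod.fst).map inv := by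
    rw [List.flatMap_map, List.map_flatMap]
  obtain ⟨gs, g1, g2, g3⟩ := exists_combDicke (G := H.comap place) (B := B) (L := L) hk
    (strips.map fun s => (s.1.map inv, s.2.map inv)) (by simpa using hne)
    (by
      rw [e1]
      refine List.Nodup.map_on ?_ hnd
      intro a ha b hb hab
      rw [← h1 a (hperm.mem_iff.2 ha), hab, h1 b (hperm.mem_iff.2 hb)])
    (by
      intro s hs
      obtain ⟨t, ht, rfl⟩ := List.mem_map.1 hs
      simp only [← List.map_append]
      exact hchain _ (hmem t ht) (hch t ht))
    (by
      rw [e2]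
      exact hchain _ (fun v hv => List.mem_append.2 (Or.inl hv)) hcol)
    (by
      intro s hs
      obtain ⟨t, ht, rfl⟩ := List.mem_map.1 hs
      simpa using hB t ht)
    (by
      intro s hs
      obtain ⟨t, ht, rfl⟩ := List.mem_map.1 hs
      simpa using hL t ht)
  rw [e1, List.length_map, List.length_map, ← hperm.length_eq] at g2
  rw [e1, e2] at g3
  obtain ⟨C, c1, c2, c3, c4⟩ := g1.exists_circuit
  refine ⟨place, C, c1, ?_, ?_, c4 ▸ g2, fun i => hperm.mem_iff.1 (h2 i)⟩
  · rw [c2]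
    have hW : ((strips.flatMap fun s => s.1 ++ s.2).map inv).toFinset = Finset.univ := by
      ext i
      simp only [List.mem_toFinset, List.mem_map, Finset.mem_univ, iff_true]
      exact ⟨place i, hperm.mem_iff.1 (h2 i), h3 i⟩
    rw [hW] at g3
    refine isDickeUnitary_of_preparesDicke hkn g3 fun l hl i => ?_
    have e3 : ((strips.flatMap Prod.fst).map inv).take l =
        (List.finRange cells.length).take l := by
      have e4 : cells.map inv = (strips.flatMap Prod.fst).map inv ++
          (strips.flatMap Prod.snd).map inv := List.map_append
      rw [← h4, e4, List.take_append_of_le_length]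
      rw [List.length_map]; omega
    rw [e3, List.mem_toFinset, List.mem_take_iff_getElem]
    constructor
    · rintro ⟨j, hj, rfl⟩
      simp only [List.length_finRange] at hj
      simp only [List.getElem_finRange, Fin.val_cast]
      omega
    · intro hi
      refine ⟨i.val, ?_, by simp⟩
      rw [List.length_finRange]
      have := i.isLt
      omega
  · rw [c3, List.length_map]

end Placement

/-! ### Combs in the grid -/

section Grid

/-- Neighbouring natural numbers. -/
def NatAdj (i j : ℕ) : Prop := i + 1 = j ∨ j + 1 = i

theorem NatAdj.symm {i j : ℕ} (h : NatAdj i j) : NatAdj j i := Or.symm h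

/-- The infinite quarter-plane grid. -/
def natGrid : SimpleGraph (ℕ × ℕ) where
  Adj u v := (NatAdj u.1 v.1 ∧ u.2 = v.2) ∨ (NatAdj u.2 v.2 ∧ u.1 = v.1)
  symm := ⟨fun _ _ h => h.imp (fun h => ⟨h.1.symm, h.2.symm⟩) (fun h => ⟨h.1.symm, h.2.symm⟩)⟩
  loopless := ⟨fun u h => by
    rcases h with h | h <;> rcases h.1 with h | h <;> omega⟩

/-- The boustrophedon path through the rows `rs`, starting along the columns `cs`. -/
def snake : List ℕ → List ℕ → List (ℕ × ℕ)
  | [], _ => []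
  | r :: rs, cs => cs.map (fun c => (r, c)) ++ snake rs cs.reverse

theorem length_snake (rs cs : List ℕ) : (snake rs cs).length = rs.length * cs.length := by
  induction rs generalizing cs with
  | nil => simp [snake]
  | cons r rs ih => simp [snake, ih, Nat.succ_mul, add_comm]

theorem mem_snake {rs cs : List ℕ} {u : ℕ × ℕ} : u ∈ snake rs cs ↔ u.1 ∈ rs ∧ u.2 ∈ cs := by
  induction rs generalizing cs with
  | nil => simp [snake]
  | cons r rs ih =>
    obtain ⟨i, j⟩ := u
    simp only [snake, List.mem_append, List.mem_map, ih, List.mem_reverse, List.mem_cons,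
      Prod.mk.injEq]
    constructor
    · rintro (⟨c, hc, rfl, rfl⟩ | ⟨h1, h2⟩)
      exacts [⟨Or.inl rfl, hc⟩, ⟨Or.inr h1, h2⟩]
    · rintro ⟨rfl | h1, h2⟩
      exacts [Or.inl ⟨j, h2, rfl, rfl⟩, Or.inr ⟨h1, h2⟩]

theorem nodup_snake {rs cs : List ℕ} (hrs : rs.Nodup) (hcs : cs.Nodup) : (snake rs cs).Nodup := by
  induction rs generalizing cs with
  | nil => simp [snake]
  | cons r rs ih =>
    rw [List.nodup_cons] at hrs
    rw [snake, List.nodup_append']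
    refine ⟨hcs.map fun _ _ h => (Prod.mk.inj h).2, ih hrs.2 (List.nodup_reverse.2 hcs), ?_⟩
    rintro ⟨i, j⟩ h1 h2
    rw [mem_snake] at h2
    obtain ⟨c, _, h⟩ := List.mem_map.1 h1
    rw [Prod.mk.injEq] at h
    exact hrs.1 (h.1 ▸ h2.1)

/-- Reversing the columns lets each row start in the column where the previous row ended. -/
theorem isChain_snake {rs cs : List ℕ} (hrs : rs.IsChain NatAdj) (hcs : cs.IsChain NatAdj) :
    (snake rs cs).IsChain natGrid.Adj := by
  induction rs generalizing cs with
  | nil => simp [snake]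
  | cons r rs ih =>
    rw [List.isChain_cons] at hrs
    have hrev : cs.reverse.IsChain NatAdj := by
      rw [List.isChain_reverse]
      exact hcs.imp fun _ _ h => NatAdj.symm h
    rw [snake, List.isChain_append]
    refine ⟨?_, ih hrs.2 hrev, ?_⟩
    · rw [List.isChain_map]
      exact hcs.imp fun _ _ h => Or.inr ⟨h, rfl⟩
    · intro x hx y hy
      cases rs with
      | nil => simp [snake] at hy
      | cons r' rs =>
        have hr := hrs.1 r' (by simp)
        rw [List.getLast?_map] at hx
        obtain ⟨c, hc, rfl⟩ := Option.mem_map.1 hx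
        rw [snake, List.head?_append, List.head?_map, List.head?_reverse, hc] at hy
        simp only [Option.map_some, Option.some_or, Option.mem_def, Option.some.injEq] at hy
        subst hy
        exact Or.inl ⟨hr, rfl⟩

theorem head?_snake (r c : ℕ) (rs cs : List ℕ) : (snake (r :: rs) (c :: cs)).head? = some (r, c) := by
  simp [snake]

/-- Each pair of rows runs through the columns and back, so an even number of rows ends in the
initial column. -/
theorem getLast?_snake_even (rs : List ℕ) (m : ℕ) (hm : rs.length = 2 * m) (cs : List ℕ) (c r : ℕ)
    (hc : cs.head? = some c) (hr : rs.getLast? = some r) :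
    (snake rs cs).getLast? = some (r, c) := by
  induction m generalizing rs with
  | zero =>
    have : rs = [] := List.length_eq_zero_iff.1 hm
    simp [this] at hr
  | succ m ih =>
    obtain ⟨r₁, rs, rfl⟩ := List.exists_cons_of_length_eq_add_one (n := 2 * m + 1) hm
    obtain ⟨r₂, rs, rfl⟩ := List.exists_cons_of_length_eq_add_one (l := rs) (n := 2 * m)
      (by rw [List.length_cons] at hm; omega)
    simp only [List.length_cons] at hm
    rw [snake, snake, List.reverse_reverse]
    cases rs with
    | nil =>
      simp only [List.getLast?_cons_cons, List.getLast?_singleton, Option.some.injEq] at hr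
      subst hr
      simp only [snake, List.append_nil]
      rw [List.getLast?_append, List.getLast?_map, List.getLast?_reverse, hc]
      simp
    | cons r₃ rs =>
      rw [List.getLast?_cons_cons, List.getLast?_cons_cons] at hr
      have := ih (r₃ :: rs) (by simp only [List.length_cons] at hm ⊢; omega) hr
      rw [List.getLast?_append, List.getLast?_append, this]
      simp

/-- The numbers `t + h - 1, …, t`. -/
def downFrom (t h : ℕ) : List ℕ := (List.range' t h).reverse

theorem isChain_range' (t h : ℕ) : (List.range' t h).IsChain NatAdj := by
  rw [List.isChain_iff_getElem]
  intro i hi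
  left
  simp only [List.getElem_range']
  ring

theorem isChain_downFrom (t h : ℕ) : (downFrom t h).IsChain NatAdj := by
  rw [downFrom, List.isChain_reverse]
  exact (isChain_range' t h).imp fun _ _ h => NatAdj.symm h

theorem nodup_downFrom (t h : ℕ) : (downFrom t h).Nodup :=
  List.nodup_reverse.2 List.nodup_range'

theorem mem_downFrom {t h i : ℕ} : i ∈ downFrom t h ↔ t ≤ i ∧ i < t + h := by
  simp [downFrom, List.mem_range'_1]

theorem length_downFrom (t h : ℕ) : (downFrom t h).length = h := by simp [downFrom]

theorem downFrom_succ (t h : ℕ) : downFrom t (h + 1) = (t + h) :: downFrom t h := by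
  simp [downFrom, List.range'_concat]

theorem getLast?_downFrom (t h : ℕ) : (downFrom t (h + 1)).getLast? = some t := by
  simp [downFrom, List.range'_succ]

/-- The left part of a horizontal strip, as a path ending in its lower right corner. -/
def stripBlock (w t h : ℕ) : List (ℕ × ℕ) := (snake (downFrom t h) (downFrom 0 w)).reverse

/-- The right part of a horizontal strip, as a path starting in its lower left corner. -/
def stripRest (w b t h : ℕ) : List (ℕ × ℕ) := snake (downFrom t h) (List.range' w (b - w))

theorem length_stripBlock (w t h : ℕ) : (stripBlock w t h).length = h * w := by
  rw [stripBlock, List.length_reverse, length_snake, length_downFrom, length_downFrom]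

theorem length_stripRest (w b t h : ℕ) : (stripRest w b t h).length = h * (b - w) := by
  rw [stripRest, length_snake, length_downFrom, List.length_range']

theorem mem_stripBlock {w t h : ℕ} {u : ℕ × ℕ} :
    u ∈ stripBlock w t h ↔ (t ≤ u.1 ∧ u.1 < t + h) ∧ u.2 < w := by
  simp [stripBlock, mem_snake, mem_downFrom]

theorem mem_stripRest {w b t h : ℕ} (hw : w ≤ b) {u : ℕ × ℕ} :
    u ∈ stripRest w b t h ↔ (t ≤ u.1 ∧ u.1 < t + h) ∧ w ≤ u.2 ∧ u.2 < b := by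
  simp [stripRest, mem_snake, mem_downFrom, List.mem_range'_1, hw]

theorem nodup_strip {w b : ℕ} (hw : w ≤ b) (t h : ℕ) :
    (stripBlock w t h ++ stripRest w b t h).Nodup := by
  rw [List.nodup_append']
  refine ⟨List.nodup_reverse.2 (nodup_snake (nodup_downFrom _ _) (nodup_downFrom _ _)),
    nodup_snake (nodup_downFrom _ _) List.nodup_range', ?_⟩
  intro u h1 h2
  rw [mem_stripBlock] at h1
  rw [mem_stripRest hw] at h2
  omega

theorem isChain_stripBlock (w t h : ℕ) : (stripBlock w t h).IsChain natGrid.Adj := by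
  rw [stripBlock, List.isChain_reverse]
  exact (isChain_snake (isChain_downFrom _ _) (isChain_downFrom _ _)).imp
    fun _ _ h => SimpleGraph.Adj.symm h

theorem getLast?_stripBlock {w h : ℕ} (hw : 1 ≤ w) (hh : 1 ≤ h) (t : ℕ) :
    (stripBlock w t h).getLast? = some (t + h - 1, w - 1) := by
  obtain ⟨w, rfl⟩ := Nat.exists_eq_add_of_le' hw
  obtain ⟨h, rfl⟩ := Nat.exists_eq_add_of_le' hh
  rw [stripBlock, List.getLast?_reverse, downFrom_succ, downFrom_succ, head?_snake]
  simp

/-- Even height makes the block begin in its right column, directly below the end of the block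
above; this is why strips have height `2 * g`. -/
theorem head?_stripBlock {w m : ℕ} (hw : 1 ≤ w) (hm : 1 ≤ m) (t : ℕ) :
    (stripBlock w t (2 * m)).head? = some (t, w - 1) := by
  obtain ⟨w, rfl⟩ := Nat.exists_eq_add_of_le' hw
  rw [stripBlock, List.head?_reverse]
  apply getLast?_snake_even _ m (length_downFrom _ _)
  · simp [downFrom_succ]
  · obtain ⟨m, rfl⟩ := Nat.exists_eq_add_of_le' hm
    exact getLast?_downFrom t (2 * m + 1)

/-- The block ends in its lower right corner, next to the lower left corner where the right part
begins. -/
theorem isChain_strip {w b h : ℕ} (hw : 1 ≤ w) (hwb : w < b) (hh : 1 ≤ h) (t : ℕ) :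
    (stripBlock w t h ++ stripRest w b t h).IsChain natGrid.Adj := by
  rw [List.isChain_append]
  refine ⟨isChain_stripBlock w t h, isChain_snake (isChain_downFrom _ _) (isChain_range' _ _), ?_⟩
  intro x hx y hy
  rw [getLast?_stripBlock hw hh] at hx
  obtain ⟨h, rfl⟩ := Nat.exists_eq_add_of_le' hh
  obtain ⟨e, he⟩ : ∃ e, b - w = e + 1 := ⟨b - w - 1, by omega⟩
  rw [stripRest, downFrom_succ, he, List.range'_succ, head?_snake] at hy
  simp only [Option.mem_def, Option.some.injEq] at hx hy
  subst hx hy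
  right
  constructor
  · left
    simp only
    omega
  · simp only
    omega

/-- A stack of `m` strips of height `h`, from row `t` downwards. -/
def stack (w b h : ℕ) : ℕ → ℕ → List (List (ℕ × ℕ) × List (ℕ × ℕ))
  | _, 0 => []
  | t, m + 1 => (stripBlock w t h, stripRest w b t h) :: stack w b h (t + h) m

theorem length_stack (w b h t m : ℕ) : (stack w b h t m).length = m := by
  induction m generalizing t with
  | zero => rfl
  | succ m ih => simp [stack, ih]

theorem mem_stack {w b h t m : ℕ} {s : List (ℕ × ℕ) × List (ℕ × ℕ)} (hs : s ∈ stack w b h t m) :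
    ∃ t', t ≤ t' ∧ t' + h ≤ t + m * h ∧ s = (stripBlock w t' h, stripRest w b t' h) := by
  induction m generalizing t with
  | zero => simp [stack] at hs
  | succ m ih =>
    rw [Nat.succ_mul]
    rcases List.mem_cons.1 hs with rfl | hs
    · exact ⟨t, le_rfl, by omega, rfl⟩
    · obtain ⟨t', h1, h2, h3⟩ := ih hs
      exact ⟨t', by omega, by omega, h3⟩

theorem mem_flatMap_stack {w b h t m : ℕ} (hw : w ≤ b) {u : ℕ × ℕ}
    (hu : u ∈ (stack w b h t m).flatMap fun s => s.1 ++ s.2) :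
    t ≤ u.1 ∧ u.1 < t + m * h ∧ u.2 < b := by
  obtain ⟨s, hs, hu⟩ := List.mem_flatMap.1 hu
  obtain ⟨t', h1, h2, rfl⟩ := mem_stack hs
  rw [List.mem_append, mem_stripBlock, mem_stripRest hw] at hu
  omega

theorem nodup_stack {w b : ℕ} (hw : w ≤ b) (h t m : ℕ) :
    ((stack w b h t m).flatMap fun s => s.1 ++ s.2).Nodup := by
  induction m generalizing t with
  | zero => simp [stack]
  | succ m ih =>
    rw [stack, List.flatMap_cons, List.nodup_append']
    refine ⟨nodup_strip hw t h, ih _, ?_⟩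
    intro u h1 h2
    have := mem_flatMap_stack hw h2
    rw [List.mem_append, mem_stripBlock, mem_stripRest hw] at h1
    omega

theorem length_flatMap_stack {w b : ℕ} (hw : w ≤ b) (h t m : ℕ) :
    ((stack w b h t m).flatMap fun s => s.1 ++ s.2).length = m * h * b := by
  induction m generalizing t with
  | zero => simp [stack]
  | succ m ih =>
    rw [stack, List.flatMap_cons, List.length_append, ih, List.length_append, length_stripBlock,
      length_stripRest, ← Nat.mul_add, Nat.add_sub_cancel' hw]
    ring

/-- A path ending above the upper right corner of the first block extends through all blocks. -/
theorem isChain_append_stack {w b g m t : ℕ} (hw : 1 ≤ w) (hg : 1 ≤ g) (ht : 1 ≤ t)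
    (l : List (ℕ × ℕ)) (hl : l.IsChain natGrid.Adj) (hlast : l.getLast? = some (t - 1, w - 1)) :
    (l ++ (stack w b (2 * g) t m).flatMap Prod.fst).IsChain natGrid.Adj := by
  induction m generalizing t l with
  | zero => simpa [stack] using hl
  | succ m ih =>
    rw [stack, List.flatMap_cons, ← List.append_assoc]
    apply ih (by omega)
    · rw [List.isChain_append]
      refine ⟨hl, isChain_stripBlock _ _ _, ?_⟩
      intro x hx y hy
      rw [hlast] at hx
      rw [head?_stripBlock hw hg] at hy
      simp only [Option.mem_def, Option.some.injEq] at hx hy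
      subst hx hy
      exact Or.inl ⟨Or.inl (by simp only; omega), rfl⟩
    · rw [List.getLast?_append, getLast?_stripBlock hw (by omega)]
      simp

/-- Circuits on combs in the infinite grid are circuits in a finite grid containing them. -/
theorem exists_circuit_grid {n k a b D N : ℕ}
    (h : ∃ (place : Fin n ↪ ℕ × ℕ) (circ : Circuit (Fin n)),
      circ.Respects (natGrid.comap place) ∧ IsDickeUnitary n k circ.matrix ∧ circ.depth ≤ D ∧
      circ.size ≤ N ∧ ∀ i, (place i).1 < a ∧ (place i).2 < b) :
    ∃ (place : Fin n ↪ Fin a × Fin b) (circ : Circuit (Fin n)),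
      circ.Respects ((grid a b).comap place) ∧ IsDickeUnitary n k circ.matrix ∧ circ.depth ≤ D ∧
      circ.size ≤ N := by
  obtain ⟨place, circ, h1, h2, h3, h4, h5⟩ := h
  refine ⟨⟨fun i => (⟨(place i).1, (h5 i).1⟩, ⟨(place i).2, (h5 i).2⟩), ?_⟩, circ, ?_, h2, h3, h4⟩
  · intro i j hij
    simp only [Prod.mk.injEq, Fin.mk.injEq] at hij
    exact place.injective (Prod.ext hij.1 hij.2)
  · intro L hL g hg
    have := h1 L hL g hg
    cases g with
    | one q U => trivial
    | two p q hpq U =>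
      simp only [Gate.Respects, SimpleGraph.comap_adj] at this ⊢
      rw [SimpleGraph.boxProd_adj, SimpleGraph.pathGraph_adj, SimpleGraph.pathGraph_adj]
      rcases this with ⟨h, e⟩ | ⟨h, e⟩
      exacts [Or.inl ⟨h, Fin.ext e⟩, Or.inr ⟨h, Fin.ext e⟩]

/-- A comb with a single strip that is all spine, `B = L = n`. These bounds are of the desired order
when `n = O(k)`. -/
theorem exists_circuit_snake {n k a b : ℕ} (hk : 1 ≤ k) (hkn : k ≤ n) (hn : n ≤ a * b) :
    ∃ (place : Fin n ↪ Fin a × Fin b) (circ : Circuit (Fin n)),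
      circ.Respects ((grid a b).comap place) ∧ IsDickeUnitary n k circ.matrix ∧
      circ.depth ≤ 105 * n ∧ circ.size ≤ 22 * (n * n) + 33 * (k * n) := by
  apply exists_circuit_grid
  set path := (snake (downFrom 0 a) (downFrom 0 b)).take n with hpath
  have hlen : path.length = n := by
    rw [hpath, List.length_take, length_snake, length_downFrom, length_downFrom]
    omega
  have hch : path.IsChain natGrid.Adj :=
    (isChain_snake (isChain_downFrom _ _) (isChain_downFrom _ _)).take _
  have hnd : path.Nodup :=
    (nodup_snake (nodup_downFrom _ _) (nodup_downFrom _ _)).sublist (List.take_sublist _ _)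
  obtain ⟨place, circ, h1, h2, h3, h4, h5⟩ := exists_circuit_of_comb natGrid (n := n) (k := k)
    (B := n) (L := n) hk [(path, [])] (by simp) (by simpa using hnd) (by simpa using hch)
    (by simpa using hch) (by simp [hlen, hkn]) (by simp [hlen]) (by simp [hlen])
  refine ⟨place, circ, h1, h2, ?_, ?_, ?_⟩
  · rw [h3, List.length_singleton]
    omega
  · rw [List.length_singleton] at h4
    omega
  · intro i
    have := h5 i
    simp only [List.flatMap_cons, List.flatMap_nil, List.append_nil] at this
    have := List.mem_of_mem_take this
    rw [mem_snake, mem_downFrom, mem_downFrom] at this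
    omega

/-- Dicke circuits on a grid divided into one strip of height `h₀` and `m` strips of height
`2 * g`, where the last `cut` cells of the first strip are not used. -/
theorem exists_circuit_strips {n k a b h₀ g m w cut B L : ℕ} (hk : 1 ≤ k) (hg : 1 ≤ g)
    (hgh : 2 * g ≤ h₀) (hw : 1 ≤ w) (hwb : w < b) (hkw : k ≤ 2 * g * w)
    (ha : h₀ + m * (2 * g) ≤ a) (hn : n + cut = (h₀ + m * (2 * g)) * b)
    (hcut : cut ≤ h₀ * (b - w)) (hB : h₀ * w ≤ B) (hL : h₀ * b ≤ L) :
    ∃ (place : Fin n ↪ Fin a × Fin b) (circ : Circuit (Fin n)),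
      circ.Respects ((grid a b).comap place) ∧ IsDickeUnitary n k circ.matrix ∧
      circ.depth ≤ 42 * B * (m + 1) + 63 * L ∧
      circ.size ≤ 22 * (B * B) * (m + 1) + 33 * (k * n) := by
  apply exists_circuit_grid
  -- Superfluous cells are removed at the far end of the first strip, so that it remains a path and
  -- no spine cell is lost.
  set rest := (stripRest w b 0 h₀).take (h₀ * (b - w) - cut) with hrest
  have hrlen : rest.length = h₀ * (b - w) - cut := by
    rw [hrest, List.length_take, length_stripRest]
    omega
  have hsplit : ∀ h, h * w + h * (b - w) = h * b := fun h => by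
    rw [← Nat.mul_add, Nat.add_sub_cancel' hwb.le]
  have htake : stripBlock w 0 h₀ ++ rest =
      (stripBlock w 0 h₀ ++ stripRest w b 0 h₀).take (h₀ * w + (h₀ * (b - w) - cut)) := by
    rw [List.take_append, length_stripBlock, Nat.add_sub_cancel_left, List.take_of_length_le]
    rw [length_stripBlock]
    omega
  have hmem : ∀ u ∈ stripBlock w 0 h₀ ++ rest, u.1 < h₀ ∧ u.2 < b := by
    intro u hu
    rw [htake] at hu
    have := List.mem_of_mem_take hu
    rw [List.mem_append, mem_stripBlock, mem_stripRest hwb.le] at this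
    omega
  have hw2 : 2 * g * w ≤ h₀ * w := Nat.mul_le_mul_right _ hgh
  have hb2 : 2 * g * b ≤ h₀ * b := Nat.mul_le_mul_right _ hgh
  obtain ⟨place, circ, h1, h2, h3, h4, h5⟩ := exists_circuit_of_comb natGrid (n := n) (k := k)
    (B := B) (L := L) hk ((stripBlock w 0 h₀, rest) :: stack w b (2 * g) h₀ m) (by simp)
    (by
      rw [List.flatMap_cons, List.nodup_append']
      refine ⟨?_, nodup_stack hwb.le _ _ _, ?_⟩
      · simp only [htake]
        exact (nodup_strip hwb.le 0 h₀).sublist (List.take_sublist _ _)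
      · intro u hu hu'
        have e1 := hmem u hu
        have e2 := mem_flatMap_stack hwb.le hu'
        omega)
    (by
      intro s hs
      rcases List.mem_cons.1 hs with rfl | hs
      · simp only [htake]
        exact (isChain_strip hw hwb (by omega) 0).take _
      · obtain ⟨t, _, _, rfl⟩ := mem_stack hs
        exact isChain_strip hw hwb (by omega) t)
    (by
      rw [List.flatMap_cons]
      -- Only the end of the first block matters for the spine, so its height `h₀` may be odd.
      refine isChain_append_stack hw hg (by omega) _ (isChain_stripBlock _ _ _) ?_
      rw [getLast?_stripBlock hw (by omega), zero_add])
    (by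
      intro s hs
      rcases List.mem_cons.1 hs with rfl | hs
      · simp only [length_stripBlock]
        omega
      · obtain ⟨t, _, _, rfl⟩ := mem_stack hs
        simp only [length_stripBlock]
        omega)
    (by
      intro s hs
      rcases List.mem_cons.1 hs with rfl | hs
      · simp only [List.length_append, length_stripBlock, hrlen]
        have := hsplit h₀
        omega
      · obtain ⟨t, _, _, rfl⟩ := mem_stack hs
        simp only [List.length_append, length_stripBlock, length_stripRest]
        have := hsplit (2 * g)
        omega)
    (by
      rw [List.flatMap_cons, List.length_append, length_flatMap_stack hwb.le, List.length_append,
        length_stripBlock, hrlen]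
      have := hsplit h₀
      rw [Nat.add_mul] at hn
      omega)
  rw [List.length_cons, length_stack] at h3 h4
  refine ⟨place, circ, h1, h2, h3.le, h4, ?_⟩
  intro i
  have := h5 i
  rw [List.flatMap_cons, List.mem_append] at this
  rcases this with h | h
  · have := hmem _ h
    omega
  · have := mem_flatMap_stack hwb.le h
    omega

end Grid

/-! ### Choice of the parameters -/

section Parameters

/-- Dicke circuits on grids with at least `E² k` qubits. -/
theorem exists_circuit_of_large {n k a b : ℕ} {C E : ℝ} (hC : 0 < C) (hE : E = 4 + 2 * C)
    (hk : 1 ≤ k) (hab : a ≤ b) (hn : n ≤ a * b) (hb : (b : ℝ) ≤ C * Real.sqrt (n * k))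
    (hlarge : E ^ 2 * k ≤ n) :
    ∃ (place : Fin n ↪ Fin a × Fin b) (circ : Circuit (Fin n)),
      circ.Respects ((grid a b).comap place) ∧ IsDickeUnitary n k circ.matrix ∧
      (circ.depth : ℝ) ≤ 168 * E * Real.sqrt (n * k) ∧ (circ.size : ℝ) ≤ 2233 * (k * n) := by
  have hk1 : (1 : ℝ) ≤ k := by exact_mod_cast hk
  have hE4 : 4 < E := by linarith
  have hn16 : (16 : ℝ) ≤ n := by nlinarith
  set X := Real.sqrt (n * k) with hX
  have hXX : X * X = n * k := Real.mul_self_sqrt (by positivity)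
  have hXpos : 0 < X := Real.sqrt_pos.2 (by positivity)
  -- The assumption `E² k ≤ n` amounts to `E X ≤ n` and `E k ≤ X`, the two forms in which it is
  -- used.
  have hEX : E * X ≤ n := by
    apply le_of_sq_le_sq _ (by positivity)
    calc (E * X) ^ 2 = E ^ 2 * (X * X) := by ring
      _ = (E ^ 2 * k) * n := by rw [hXX]; ring
      _ ≤ n * n := by gcongr
      _ = (n : ℝ) ^ 2 := by ring
  have hEX' : E * X = 4 * X + 2 * (C * X) := by rw [hE]; ring
  have hEk : E * k ≤ X := by
    have : (E * k) * X ≤ X * X := by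
      calc (E * k) * X = (E * X) * k := by ring
        _ ≤ n * k := by gcongr
        _ = X * X := hXX.symm
    exact le_of_mul_le_mul_right this hXpos
  have hbb : (n : ℝ) ≤ b * b := by
    have : n ≤ b * b := hn.trans (Nat.mul_le_mul_right _ hab)
    exact_mod_cast this
  have hb4 : (4 : ℝ) ≤ b := by nlinarith [(Nat.cast_nonneg b : (0 : ℝ) ≤ b)]
  have hbpos : (0 : ℝ) < b := by linarith
  have hbnat : 4 ≤ b := by exact_mod_cast hb4
  -- Strips of height `2 * g` have between `2X` and `2(X + b)` cells, which is `O(X)` because `b ≤ C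
  -- X`.
  obtain ⟨g, hg⟩ : ∃ g, g = ⌈X / b⌉₊ := ⟨_, rfl⟩
  have hg1 : X ≤ g * b := by
    have := Nat.le_ceil (X / b)
    rw [← hg, div_le_iff₀ hbpos] at this
    exact this
  have hg2 : (g : ℝ) * b ≤ X + b := by
    have := (Nat.ceil_lt_add_one (by positivity : 0 ≤ X / b)).le
    rw [← hg] at this
    calc (g : ℝ) * b ≤ (X / b + 1) * b := by gcongr
      _ = X + b := by field_simp
  have hgpos : 1 ≤ g := by
    rw [hg]; exact Nat.one_le_ceil_iff.2 (by positivity)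
  have hg1' : (1 : ℝ) ≤ g := by exact_mod_cast hgpos
  have hgk : (g : ℝ) ≤ 2 * k := by
    have h1 : X / b ≤ k := by
      rw [div_le_iff₀ hbpos]
      apply le_of_sq_le_sq _ (by positivity)
      calc X ^ 2 = n * k := by rw [sq, hXX]
        _ ≤ (b * b) * (k * k) :=
          mul_le_mul hbb (le_mul_of_one_le_left (by positivity) hk1) (by positivity) (by positivity)
        _ = (k * b) ^ 2 := by ring
    have := (Nat.ceil_lt_add_one (by positivity : 0 ≤ X / b)).le
    rw [← hg] at this
    linarith
  -- The number of rows that are really needed, `⌈n / b⌉`; fewer than `b` cells are left over.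
  obtain ⟨r, hr⟩ : ∃ r, r = (n + b - 1) / b := ⟨_, rfl⟩
  have hr1 : n ≤ r * b := by
    have := Nat.lt_div_mul_add (a := n + b - 1) (b := b) (by omega)
    rw [← hr] at this
    omega
  have hr2 : r * b ≤ n + b - 1 := hr ▸ Nat.div_mul_le_self _ _
  have hra : r ≤ a := by
    rw [hr]
    apply Nat.le_of_lt_succ
    rw [Nat.div_lt_iff_lt_mul (by omega), Nat.succ_mul]
    omega
  have hr1' : (n : ℝ) ≤ r * b := by exact_mod_cast hr1
  have hr2' : (r : ℝ) * b ≤ n + b := by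
    have : r * b ≤ n + b := by omega
    exact_mod_cast this
  have hrg : 2 * g ≤ r := by
    have : ((2 * g : ℕ) : ℝ) * b ≤ r * b := by
      push_cast
      linarith
    exact_mod_cast le_of_mul_le_mul_right this hbpos
  -- There are `R` strips; the first one absorbs the remaining `r % (2 * g)` rows, which less than
  -- doubles its height.
  obtain ⟨R, hR⟩ : ∃ R, R = r / (2 * g) := ⟨_, rfl⟩
  have hRpos : 1 ≤ R := by
    rw [hR]; exact (Nat.one_le_div_iff (by omega)).2 hrg
  have hRr : 2 * g * R + r % (2 * g) = r := hR ▸ Nat.div_add_mod r (2 * g)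
  have hmod : r % (2 * g) < 2 * g := Nat.mod_lt _ (by omega)
  obtain ⟨m, hm⟩ : ∃ m, R = m + 1 := ⟨R - 1, by omega⟩
  -- The least width for which a block of height `2 * g` holds `k` cells.
  obtain ⟨w, hw⟩ : ∃ w, w = (k + 2 * g - 1) / (2 * g) := ⟨_, rfl⟩
  have hw1 : k ≤ 2 * g * w := by
    have := Nat.lt_div_mul_add (a := k + 2 * g - 1) (b := 2 * g) (by omega)
    rw [← hw, mul_comm w] at this
    omega
  have hw2 : 2 * g * w ≤ k + 2 * g - 1 := by
    rw [mul_comm]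
    exact hw ▸ Nat.div_mul_le_self _ _
  have hwpos : 1 ≤ w := by
    by_contra h
    have : w = 0 := by omega
    rw [this] at hw1
    omega
  have hw2' : 2 * (g : ℝ) * w ≤ k + 2 * g := by
    have : 2 * g * w ≤ k + 2 * g := by omega
    exact_mod_cast this
  have hwb : 2 * w ≤ b := by
    have h0 : (g : ℝ) * 4 ≤ g * b := by gcongr
    have h4k : 4 * (k : ℝ) ≤ E * k := by gcongr
    have h1 : 2 * (g : ℝ) * (2 * w) ≤ 2 * g * b := by linarith
    exact_mod_cast le_of_mul_le_mul_left h1 (by positivity)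
  have hh0 : 2 * g + r % (2 * g) + m * (2 * g) = r := by
    have e : 2 * g * (m + 1) = m * (2 * g) + 2 * g := by ring
    rw [hm, e] at hRr
    omega
  obtain ⟨cut, hcut⟩ : ∃ cut, n + cut = r * b := ⟨r * b - n, by omega⟩
  -- The right part of the first strip has at least `b` cells, enough to absorb the cut.
  have hbw : b ≤ (2 * g + r % (2 * g)) * (b - w) := by
    calc b ≤ 2 * (b - w) := by omega
      _ ≤ _ := Nat.mul_le_mul_right _ (by omega)
  have hgk' : g ≤ 2 * k := by exact_mod_cast hgk
  -- From `2 * g * w < k + 2 * g` and `g ≤ 2 * k`, doubled for the taller first strip.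
  have hB : (2 * g + r % (2 * g)) * w ≤ 10 * k := by
    calc (2 * g + r % (2 * g)) * w ≤ (2 * (2 * g)) * w := Nat.mul_le_mul_right _ (by omega)
      _ = 2 * (2 * g * w) := by ring
      _ ≤ _ := by omega
  have hL : (2 * g + r % (2 * g)) * b ≤ 4 * g * b := Nat.mul_le_mul_right _ (by omega)
  obtain ⟨place, circ, h1, h2, h3, h4⟩ := exists_circuit_strips (n := n) (k := k) (a := a) (b := b)
    (h₀ := 2 * g + r % (2 * g)) (g := g) (m := m) (w := w) (cut := cut) hk hgpos (by omega) hwpos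
    (by omega) hw1 (by omega) (by rw [hh0, hcut]) (by omega) hB hL
  rw [← hm] at h3 h4
  have hRX : (R : ℝ) * X ≤ n := by
    have e1 : 2 * g * R ≤ r := by omega
    have e2 : 2 * (g : ℝ) * R ≤ r := by exact_mod_cast e1
    have e3 : (R : ℝ) * (2 * X) ≤ R * (2 * (g * b)) := by gcongr
    have e4 : (R : ℝ) * (2 * (g * b)) ≤ r * b := by
      calc (R : ℝ) * (2 * (g * b)) = (2 * g * R) * b := by ring
        _ ≤ r * b := by gcongr
    linarith
  -- This balances the two contributions to the depth: the spine takes `O(k R)` and the strips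
  -- `O(X)`.
  have hkR : (k : ℝ) * R ≤ X := by
    have : (k * R) * X ≤ X * X := by
      calc (k * R) * X = (R * X) * k := by ring
        _ ≤ n * k := by gcongr
        _ = X * X := hXX.symm
    exact le_of_mul_le_mul_right this hXpos
  refine ⟨place, circ, h1, h2, ?_, ?_⟩
  · have h3' : (circ.depth : ℝ) ≤ 42 * (10 * k) * R + 63 * (4 * g * b) := by exact_mod_cast h3
    linarith
  · have h4' : (circ.size : ℝ) ≤ 22 * (10 * k * (10 * k)) * R + 33 * (k * n) := by
      exact_mod_cast h4
    have hXn : X ≤ n := by linarith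
    have : (k : ℝ) * (k * R) ≤ k * n := by
      gcongr
      linarith
    linarith

end Parameters
end DickeCircuit

theorem theorem2 (c C : ℝ) (hc : 0 < c) (hC : 0 < C) :
    ∃ K : ℝ, 0 < K ∧
      ∀ (n k a b : ℕ) (s : ℝ),
        1 ≤ s → s ≤ k → k ≤ n →
        a ≤ b → n ≤ a * b →
        c * Real.sqrt (n / s) ≤ a → (b : ℝ) ≤ C * Real.sqrt (n * s) →
        ∃ (place : Fin n ↪ Fin a × Fin b) (circ : DickeCircuit.Circuit (Fin n)),
          circ.Respects ((DickeCircuit.grid a b).comap place) ∧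
          DickeCircuit.IsDickeUnitary n k circ.matrix ∧
          (circ.depth : ℝ) ≤ K * (k * Real.sqrt (n / k)) ∧
          (circ.size : ℝ) ≤ K * (k * n) := by
  obtain ⟨E, hE⟩ : ∃ E : ℝ, E = 4 + 2 * C := ⟨_, rfl⟩
  have hE4 : 4 < E := by linarith
  -- Since `E > 4`, this exceeds `168 * E` and `2233` from the strips as well as `105 * E` and `22 *
  -- E ^ 2 + 33` from the single path.
  refine ⟨200 * E ^ 2, by positivity, ?_⟩
  intro n k a b s hs1 hsk hkn hab hn _ hb
  have hk1 : (1 : ℝ) ≤ k := hs1.trans hsk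
  have hk : 1 ≤ k := by exact_mod_cast hk1
  have hkn' : (k : ℝ) ≤ n := by exact_mod_cast hkn
  have hX : (k : ℝ) * Real.sqrt (n / k) = Real.sqrt (n * k) := by
    rw [show (n : ℝ) * k = k ^ 2 * (n / k) by field_simp, Real.sqrt_mul (by positivity),
      Real.sqrt_sq (by positivity)]
  have hb' : (b : ℝ) ≤ C * Real.sqrt (n * k) := hb.trans (by gcongr)
  rw [hX]
  have hX0 := Real.sqrt_nonneg ((n : ℝ) * k)
  have hkn0 : (0 : ℝ) ≤ k * n := by positivity
  have hEE : 4 * E ≤ E ^ 2 := by nlinarith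
  by_cases hlarge : E ^ 2 * k ≤ n
  · obtain ⟨place, circ, h1, h2, h3, h4⟩ :=
      DickeCircuit.exists_circuit_of_large hC hE hk hab hn hb' hlarge
    refine ⟨place, circ, h1, h2, h3.trans ?_, h4.trans ?_⟩
    · exact mul_le_mul_of_nonneg_right (by nlinarith) hX0
    · exact mul_le_mul_of_nonneg_right (by nlinarith) hkn0
  · push Not at hlarge
    obtain ⟨place, circ, h1, h2, h3, h4⟩ := DickeCircuit.exists_circuit_snake hk hkn hn
    refine ⟨place, circ, h1, h2, ?_, ?_⟩
    · have h3' : (circ.depth : ℝ) ≤ 105 * n := by exact_mod_cast h3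
      -- In the remaining case `n < E² k`, so linear depth is already `O(√(nk))` and `n²` gates are
      -- `O(kn)`.
      have hnX : (n : ℝ) ≤ E * Real.sqrt (n * k) := by
        apply le_of_sq_le_sq _ (by positivity)
        rw [mul_pow, Real.sq_sqrt (by positivity)]
        nlinarith
      nlinarith
    · have h4' : (circ.size : ℝ) ≤ 22 * (n * n) + 33 * (k * n) := by exact_mod_cast h4
      have hnn : (n : ℝ) * n ≤ E ^ 2 * (k * n) := by nlinarith
      nlinarith
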